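/- Let $(\Omega,\mathcal F,\mathbb F=\{\mathcal F_t\}_{t\in[0,1]},\mathbb P)$ be a filtered probability space, and let $X=\{X(t),t\in[0,1]\}$ be an $\mathbb F$-adapted real process. Let $\alpha>1/2$ and assume: (1) (Hölder continuity) for every $r\in(0,\alpha)$, almost surely there is a finite (possibly random) constant $C$ with $|X(t)-X(s)|\le C|t-s|^{r}$ for all $s,t\in[0,1]$ (in particular this holds if almost every path of $X$ is Hölder continuous of order $\alpha$); (2) (small balls near $t=1$) there are constants $\delta>0$ and $C>0$ such that for all $s\le t$ in $[1-\delta,1]\cap[0,1]$, with $\Delta=t-s$, and all $0<\varepsilon\le\Delta^{\alpha}$, $$\mathbb P\Big(\sup_{s\le u\le t}|X(u)-X(s)|\le\varepsilon\Big)\le\exp\big(-C\Delta\,\varepsilon^{-1/\alpha}\big).$$ Let $\xi$ be a random variable such that $\xi=z(1)$ a.s. for some $\mathbb F$-adapted process $\{z(t),t\in[0,1]\}$ almost all of whose paths are Hölder continuous of some fixed order $a>0$ (with a possibly random constant). Then there exist an $\mathbb F$-adapted process $\{\psi(t),t\in[0,1]\}$, almost surely continuous on $[0,1)$, and a number $\beta\in(0,1)$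 with $\beta>1-\alpha$, such that almost surely the generalized Lebesgue--Stieltjes integral of $\psi$ with respect to $X$ over the whole interval $[0,1]$ exists (with the order $\beta$) and $$\int_0^1\psi(s)\,\mathrm dX(s)=\xi .$$ Here, for $f,g:[0,1]\to\mathbb R$ with $f$ measurable and $g_{1-}(x)=g(x)-g(1)$, put $$D_{0+}^{\beta}f(x)=\tfrac1{\Gamma(1-\beta)}\Big(\tfrac{f(x)}{x^{\beta}}+\beta\int_0^x\tfrac{f(x)-f(u)}{(x-u)^{\beta+1}}\,\mathrm du\Big),$$ $$D_{1-}^{1-\beta}g(x)=\tfrac{e^{i\pi(1-\beta)}}{\Gamma(\beta)}\Big(\tfrac{g(x)}{(1-x)^{1-\beta}}+(1-\beta)\int_x^1\tfrac{g(x)-g(u)}{(u-x)^{2-\beta}}\,\mathrm du\Big).$$ The integral exists (with the order $\beta$) if $$\int_0^1\Big(\tfrac{|f(t)|}{t^{\beta}}+\int_0^t\tfrac{|f(t)-f(s)|}{(t-s)^{\beta+1}}\,\mathrm ds\Big)\mathrm dt<\infty,$$ the inner integrals in $D_{0+}^{\beta}f(x)$ and $D_{1-}^{1-\beta}g_{1-}(x)$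 converge absolutely for almost every $x\in[0,1]$, $D_{0+}^{\beta}f\in L_1[0,1]$ and $D_{1-}^{1-\beta}g_{1-}\in L_\infty[0,1]$; its value is $$\int_0^1 f\,\mathrm dg=e^{i\pi\beta}\int_0^1 D_{0+}^{\beta}f(x)\,D_{1-}^{1-\beta}g_{1-}(x)\,\mathrm dx .$$ -/

import Mathlib

open MeasureTheory Set unitInterval
open scoped ENNReal

noncomputable section

namespace GLS

/-- The left-sided fractional (Weyl–Marchaud) derivative `D_{a+}^β f` at `x`. -/
def leftDeriv (β a : ℝ) (f : ℝ → ℝ) (x : ℝ) : ℝ :=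
  1 / Real.Gamma (1 - β) *
    (f x / (x - a) ^ β + β * ∫ u in a..x, (f x - f u) / (x - u) ^ (β + 1))

/-- The right-sided fractional (Weyl–Marchaud) derivative `D_{b-}^{1-β} g` at `x`. The phase is
`(-1)^{1-β} = e^{iπ(1-β)}`, so that `∫_a^b 1 dg = g b - g a` for the integral below. -/
def rightDeriv (β b : ℝ) (g : ℝ → ℝ) (x : ℝ) : ℂ :=
  Complex.exp (Complex.I * Real.pi * (1 - β)) / (Real.Gamma β : ℂ) *
    ((g x / (b - x) ^ (1 - β)
      + (1 - β) * ∫ u in x..b, (g x - g u) / (u - x) ^ (2 - β) : ℝ) : ℂ)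

/-- The norm `‖f‖_{β;[a,b]}`, with values in `[0, ∞]`. -/
def fracNorm (β a b : ℝ) (f : ℝ → ℝ) : ℝ≥0∞ :=
  ∫⁻ t in Icc a b, (ENNReal.ofReal (|f t| / (t - a) ^ β)
    + ∫⁻ s in Icc a t, ENNReal.ofReal (|f t - f s| / (t - s) ^ (β + 1)))

/-- `HasIntegral β a b f g J`: the generalized Lebesgue–Stieltjes integral `∫_a^b f dg`, computed
with fractional derivatives of orders `β` and `1 - β`, exists as a proper integral over `[a, b]`
and equals `J`. -/
structure HasIntegral (β a b : ℝ) (f g : ℝ → ℝ) (J : ℝ) : Prop where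
  /-- `f` is measurable on `[a, b]`. -/
  aemeasurable : AEMeasurable f (volume.restrict (Icc a b))
  /-- `f` is an admissible integrand: `‖f‖_{β;[a,b]} < ∞`. -/
  norm_lt_top : fracNorm β a b f < ∞
  /-- The integral inside `D_{a+}^β f` converges at almost every point. -/
  left_integrable : ∀ᵐ x ∂(volume.restrict (Icc a b)),
    IntervalIntegrable (fun u => (f x - f u) / (x - u) ^ (β + 1)) volume a x
  /-- `D_{a+}^β f ∈ L_1[a, b]`. -/
  left_memLp : MemLp (leftDeriv β a f) 1 (volume.restrict (Icc a b))
  /-- The integral inside `D_{b-}^{1-β} g_{b-}` converges at almost every point. -/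
  right_integrable : ∀ᵐ x ∂(volume.restrict (Icc a b)),
    IntervalIntegrable (fun u => (g x - g u) / (u - x) ^ (2 - β)) volume x b
  /-- `D_{b-}^{1-β} g_{b-} ∈ L_∞[a, b]`, where `g_{b-}(x) = g(x) - g(b)`. -/
  right_memLp : MemLp (rightDeriv β b fun x => g x - g b) ∞ (volume.restrict (Icc a b))
  /-- The value of the integral. -/
  value : Complex.exp (Complex.I * Real.pi * β) *
      ∫ x in a..b, (leftDeriv β a f x : ℂ) * rightDeriv β b (fun x => g x - g b) x = (J : ℂ)

/-- Almost every path of `Y` is Hölder continuous of order `r` on `[0, 1]`, with a constant that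
may depend on the path. -/
def HolderPaths {Ω : Type*} [MeasurableSpace Ω] (P : Measure Ω) (Y : I → Ω → ℝ) (r : ℝ) : Prop :=
  ∀ᵐ ω ∂P, ∃ C : ℝ, ∀ s t : I, |Y t ω - Y s ω| ≤ C * |(t : ℝ) - s| ^ r

/-- The small ball estimate near the end point `1`; the event is
`sup_{s ≤ u ≤ t} |X(u) - X(s)| ≤ ε`. -/
def SmallBall {Ω : Type*} [MeasurableSpace Ω] (P : Measure Ω) (X : I → Ω → ℝ) (α : ℝ) : Prop :=
  ∃ δ : ℝ, 0 < δ ∧ ∃ C : ℝ, 0 < C ∧ ∀ s t : I, 1 - δ ≤ (s : ℝ) → s ≤ t →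
    ∀ ε : ℝ, 0 < ε → ε ≤ ((t : ℝ) - s) ^ α →
      P.real {ω | ∀ u ∈ Icc s t, |X u ω - X s ω| ≤ ε}
        ≤ Real.exp (-C * ((t : ℝ) - s) * ε ^ (-1 / α))

end GLS

end

noncomputable section

namespace GLS

open Filter Topology

/-! Along the times `t_n = 1 - 2 ^ (-(n + 1))`, with steps `Δ_n`, the integral is made to chase the
target `z(t_n)`. In block `n` the integrand is `gap * K'(X - X(t_n))`, stopped when `|X - X(t_n)|`
reaches a level `ε_n`. Here `K = profile ε_n` is smooth, vanishes at `0` and equals `1` at distance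
at least `ε_n`. The paths have Hölder order above `1/2`, so the integral obeys the ordinary chain
rule (`integral_marchaud_frozen`), and a block that reaches its level gains exactly `gap`, whichever
way `X` moved. As `K'` vanishes at `0` and at the level, the integrand is continuous.

Take `ε_n = Δ_n ^ ρ` with `ρ > α`. By the small ball estimate the failure probabilities are
summable, so almost surely all but finitely many blocks succeed
(`SmallBall.ae_eventually_not_unhit`). A failed block keeps its last value up to time `1`, which
amounts to a constant position in `X`; `capital` records it. Once all blocks succeed, the capital at
`t_{n+1}` is `z(t_n)` plus this position times an increment of `X`. Hence the gaps are `O(Δ_n ^ κ)`,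
and the total gain tends to `z 1` (`tendsto_sum_gain`).

For the integral to exist up to time `1`, the series of blocks has to converge in `fracNorm`. A
successful block has Hölder constant of order `|gap| / ε_n ^ 2` and support of length at most `Δ_n`,
so its norm is of order `Δ_n ^ (κ - 2ρ + 1 + r - β)` (`IsHolder.fracNorm_le_of_support`). The
exponent tends to `κ > 0` when `r, ρ → α` and `β → 1 - α`. Then `hasIntegral_of_hasSum` exchanges
sum and integral.

The chain rule is proved for smooth integrators by fractional integration by parts. Steklov averages
carry it over to Hölder integrators, because Marchaud derivatives are bounded in terms of the Hölder
constant alone. -/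

/-- `f` is globally Hölder continuous of order `r` with constant `C`. -/
def IsHolder (C r : ℝ) (f : ℝ → ℝ) : Prop :=
  ∀ s t, |f t - f s| ≤ C * |t - s| ^ r

lemma IsHolder.nonneg {C r : ℝ} {f : ℝ → ℝ} (hf : IsHolder C r f) : 0 ≤ C := by
  have h := hf 0 1
  simp only [sub_zero, abs_one, Real.one_rpow, mul_one] at h
  exact (abs_nonneg _).trans h

lemma IsHolder.continuous {C r : ℝ} {f : ℝ → ℝ} (hf : IsHolder C r f) (hr : 0 < r) :
    Continuous f := by
  rw [continuous_iff_continuousAt]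
  intro s
  rw [ContinuousAt, tendsto_iff_dist_tendsto_zero]
  have h0 : Tendsto (fun t : ℝ => C * |t - s| ^ r) (𝓝 s) (𝓝 0) := by
    have : Continuous fun t : ℝ => C * |t - s| ^ r :=
      continuous_const.mul ((continuous_id.sub continuous_const).abs.rpow_const
        fun _ => Or.inr hr.le)
    simpa [Real.zero_rpow hr.ne'] using this.tendsto s
  exact squeeze_zero (fun _ => dist_nonneg) (fun t => by rw [Real.dist_eq]; exact hf s t) h0

/-! ### Marchaud derivatives of Hölder functions -/

/-- The Weyl–Marchaud derivative from the left end point `0`, without its Gamma factor. -/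
def marchaud (β : ℝ) (f : ℝ → ℝ) (x : ℝ) : ℝ :=
  f x / x ^ β + β * ∫ u in (0 : ℝ)..x, (f x - f u) / (x - u) ^ (β + 1)

lemma leftDeriv_eq_marchaud (β : ℝ) (f : ℝ → ℝ) (x : ℝ) :
    leftDeriv β 0 f x = 1 / Real.Gamma (1 - β) * marchaud β f x := by
  simp [leftDeriv, marchaud]

/-- The reflection of `g_{1-}`, which turns right-sided derivatives into left-sided ones. -/
def reflect (g : ℝ → ℝ) (y : ℝ) : ℝ := g (1 - y) - g 1

/-- The substitution `u ↦ 1 - u` reduces everything to left-sided derivatives, so each estimate is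
proved only once. -/
lemma rightDeriv_eq_marchaud (β : ℝ) (g : ℝ → ℝ) (x : ℝ) :
    rightDeriv β 1 (fun x => g x - g 1) x =
      Complex.exp (Complex.I * Real.pi * (1 - β)) / (Real.Gamma β : ℂ) *
        (marchaud (1 - β) (reflect g) (1 - x) : ℝ) := by
  have h : ∫ u in x..1, (g x - g 1 - (g u - g 1)) / (u - x) ^ (2 - β)
      = ∫ u in (0 : ℝ)..(1 - x),
          (reflect g (1 - x) - reflect g u) / (1 - x - u) ^ (1 - β + 1) := by
    have := intervalIntegral.integral_comp_sub_left (a := (0 : ℝ)) (b := 1 - x)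
      (fun u => (g x - g 1 - (g u - g 1)) / (u - x) ^ (2 - β)) 1
    simp only [sub_sub_cancel, sub_zero] at this
    rw [← this]
    refine intervalIntegral.integral_congr fun u _ => ?_
    simp only [reflect, sub_sub_cancel]
    congr 2 <;> ring
  rw [rightDeriv, marchaud, h]
  simp only [reflect, sub_sub_cancel]

lemma IsHolder.reflect {C r : ℝ} {g : ℝ → ℝ} (hg : IsHolder C r g) :
    IsHolder C r (reflect g) := by
  intro s t
  have h := hg (1 - s) (1 - t)
  simp only [GLS.reflect]
  rw [show 1 - t - (1 - s) = -(t - s) by ring, abs_neg] at h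
  rwa [sub_sub_sub_cancel_right]

lemma reflect_zero (g : ℝ → ℝ) : reflect g 0 = 0 := by simp [reflect]

section Kernel

variable {C r β : ℝ} {f : ℝ → ℝ}

lemma IsHolder.abs_kernel_le (hf : IsHolder C r f) {x u : ℝ} (hu : u ≤ x) :
    |(f x - f u) / (x - u) ^ (β + 1)| ≤ C * (x - u) ^ (r - β - 1) := by
  rcases hu.eq_or_lt with rfl | hu
  · simpa using mul_nonneg hf.nonneg (Real.rpow_nonneg le_rfl _)
  have hxu : 0 < x - u := sub_pos.2 hu
  rw [abs_div, abs_of_pos (Real.rpow_pos_of_pos hxu _), div_le_iff₀ (Real.rpow_pos_of_pos hxu _),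
    mul_assoc, ← Real.rpow_add hxu, show r - β - 1 + (β + 1) = r by ring]
  simpa [abs_of_pos hxu] using hf u x

lemma intervalIntegrable_sub_rpow {s : ℝ} (hs : -1 < s) (x : ℝ) :
    IntervalIntegrable (fun u : ℝ => (x - u) ^ s) volume 0 x := by
  have := (intervalIntegral.intervalIntegrable_rpow' (a := x) (b := 0) hs).comp_sub_left x
  simpa using this

lemma integral_sub_rpow {s : ℝ} (hs : -1 < s) (x : ℝ) :
    ∫ u in (0 : ℝ)..x, (x - u) ^ s = x ^ (s + 1) / (s + 1) := by
  rw [intervalIntegral.integral_comp_sub_left (fun u => u ^ s) x, integral_rpow (Or.inl hs)]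
  simp [Real.zero_rpow (by linarith : s + 1 ≠ 0)]

lemma measurable_kernel (hf : Measurable f) (x : ℝ) :
    Measurable fun u => (f x - f u) / (x - u) ^ (β + 1) := by fun_prop

lemma IsHolder.intervalIntegrable_kernel (hf : IsHolder C r f) (hr : 0 < r) (hβ : β < r) {x : ℝ}
    (hx : 0 < x) :
    IntervalIntegrable (fun u => (f x - f u) / (x - u) ^ (β + 1)) volume 0 x := by
  refine ((intervalIntegrable_sub_rpow (s := r - β - 1) (by linarith) x).const_mul C).mono_fun'
    (measurable_kernel (hf.continuous hr).measurable x).aestronglyMeasurable ?_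
  rw [uIoc_of_le hx.le]
  filter_upwards [ae_restrict_mem measurableSet_Ioc] with u hu
  exact hf.abs_kernel_le hu.2

/-- The bound depends on `f` only through `C`. It therefore gives both the `L_∞` condition on the
integrator and a dominating constant for Hölder approximations. -/
lemma IsHolder.abs_marchaud_le (hf : IsHolder C r f) (hβ0 : 0 < β) (hβ : β < r)
    (h0 : f 0 = 0) {x : ℝ} (hx : 0 < x) (hx1 : x ≤ 1) :
    |marchaud β f x| ≤ C * (1 + β / (r - β)) := by
  have hC := hf.nonneg
  have hp : x ^ (r - β) ≤ 1 := Real.rpow_le_one hx.le hx1 (by linarith)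
  have h1 : |f x / x ^ β| ≤ C * x ^ (r - β) := by
    have hxb := Real.rpow_pos_of_pos hx β
    rw [abs_div, abs_of_pos hxb, div_le_iff₀ hxb, mul_assoc, ← Real.rpow_add hx, sub_add_cancel]
    simpa [h0, abs_of_pos hx] using hf 0 x
  have h2 : |∫ u in (0 : ℝ)..x, (f x - f u) / (x - u) ^ (β + 1)|
      ≤ C * (x ^ (r - β) / (r - β)) := by
    have := intervalIntegral.norm_integral_le_of_norm_le (μ := volume) hx.le
      (f := fun u => (f x - f u) / (x - u) ^ (β + 1))
      (Eventually.of_forall fun u hu => hf.abs_kernel_le (β := β) hu.2)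
      ((intervalIntegrable_sub_rpow (s := r - β - 1) (by linarith) x).const_mul C)
    rwa [intervalIntegral.integral_const_mul, integral_sub_rpow (by linarith),
      sub_add_cancel] at this
  calc |marchaud β f x| ≤ |f x / x ^ β|
        + |β * ∫ u in (0 : ℝ)..x, (f x - f u) / (x - u) ^ (β + 1)| := abs_add_le _ _
    _ ≤ C * x ^ (r - β) + β * (C * (x ^ (r - β) / (r - β))) := by
      rw [abs_mul, abs_of_pos hβ0]; gcongr
    _ = C * (1 + β / (r - β)) * x ^ (r - β) := by ring
    _ ≤ C * (1 + β / (r - β)) := by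
      refine mul_le_of_le_one_right (mul_nonneg hC ?_) hp
      have : 0 < r - β := by linarith
      positivity

/-- The common Hölder constant dominates all kernels by `C * (x - u) ^ (r - β - 1)`, which is
integrable since `β < r`. -/
lemma tendsto_marchaud {F : ℕ → ℝ → ℝ} (hF : ∀ n, IsHolder C r (F n)) (hr : 0 < r) (hβ : β < r)
    (hlim : ∀ x, Tendsto (fun n => F n x) atTop (𝓝 (f x))) {x : ℝ} (hx : 0 < x) :
    Tendsto (fun n => marchaud β (F n) x) atTop (𝓝 (marchaud β f x)) := by
  refine ((hlim x).div_const _).add (Tendsto.const_mul _ ?_)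
  refine intervalIntegral.tendsto_integral_filter_of_dominated_convergence
    (fun u => C * (x - u) ^ (r - β - 1)) (Eventually.of_forall fun n =>
      (measurable_kernel ((hF n).continuous hr).measurable x).aestronglyMeasurable)
    (Eventually.of_forall fun n => Eventually.of_forall fun u hu => ?_)
    ((intervalIntegrable_sub_rpow (by linarith) x).const_mul C)
    (Eventually.of_forall fun u _ => ((hlim x).sub (hlim u)).div_const _)
  rw [uIoc_of_le hx.le] at hu
  exact (hF n).abs_kernel_le hu.2

/-- For a Lipschitz function the Marchaud derivative is the fractional integral of the
derivative. -/
lemma marchaud_eq_integral_deriv {p : ℝ → ℝ} {s : Set ℝ} {M : ℝ} (hf : IsHolder C 1 f)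
    (h0 : f 0 = 0) (hs : s.Countable) (hd : ∀ x ∉ s, HasDerivAt f (p x) x) (hp : Measurable p)
    (hM : ∀ x, |p x| ≤ M) (hβ1 : β < 1) {x : ℝ} (hx : 0 < x) :
    marchaud β f x = ∫ v in (0 : ℝ)..x, p v * (x - v) ^ (-β) := by
  have hfc : Continuous f := hf.continuous one_pos
  have hint1 : IntervalIntegrable (fun v => p v * (x - v) ^ (-β)) volume 0 x := by
    refine ((intervalIntegrable_sub_rpow (s := -β) (by linarith) x).const_mul M).mono_fun'
      (by fun_prop) ?_
    rw [uIoc_of_le hx.le]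
    filter_upwards [ae_restrict_mem measurableSet_Ioc] with u hu
    have h : 0 ≤ (x - u) ^ (-β) := Real.rpow_nonneg (sub_nonneg.2 hu.2) _
    rw [Real.norm_eq_abs, abs_mul, abs_of_nonneg h]
    gcongr
    exact hM u
  have hint2 : IntervalIntegrable (fun u => (f x - f u) / (x - u) ^ (β + 1)) volume 0 x :=
    hf.intervalIntegrable_kernel one_pos hβ1 hx
  have hcont : ContinuousOn (fun u => (f x - f u) * (x - u) ^ (-β)) (Icc 0 x) := by
    intro u hu
    rcases hu.2.eq_or_lt with rfl | hux
    · have hlim : Tendsto (fun v : ℝ => C * (u - v) ^ (1 - β)) (𝓝[Icc 0 u] u) (𝓝 0) := by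
        have : Continuous fun v : ℝ => C * (u - v) ^ (1 - β) :=
          continuous_const.mul ((continuous_const.sub continuous_id).rpow_const
            fun _ => Or.inr (by linarith))
        have h := this.tendsto u
        simp only [sub_self, Real.zero_rpow (by linarith : 1 - β ≠ 0), mul_zero] at h
        exact h.mono_left nhdsWithin_le_nhds
      rw [ContinuousWithinAt, sub_self, zero_mul]
      refine squeeze_zero_norm' ?_ hlim
      filter_upwards [self_mem_nhdsWithin] with v hv
      -- With `β - 1` in place of `β` the kernel has denominator exponent `β`, and the bound has the
      -- positive exponent `1 - β`.
      have := hf.abs_kernel_le (β := β - 1) hv.2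
      rw [sub_add_cancel] at this
      rw [Real.rpow_neg (sub_nonneg.2 hv.2), ← div_eq_mul_inv, Real.norm_eq_abs]
      convert this using 3
      ring
    · refine ContinuousAt.continuousWithinAt ?_
      refine (continuousAt_const.sub hfc.continuousAt).mul
        ((continuousAt_const.sub continuousAt_id).rpow_const (Or.inl ?_))
      exact (sub_pos.2 hux).ne'
  -- The boundary term at `u = 0` of this primitive is, up to sign, the term `f x / x ^ β` of
  -- `marchaud`; the one at `u = x` vanishes because `f` is Lipschitz and `β < 1`.
  have key := integral_eq_of_hasDerivAt_off_countable_of_le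
    (fun u => (f x - f u) * (x - u) ^ (-β))
    (fun u => β * ((f x - f u) / (x - u) ^ (β + 1)) - p u * (x - u) ^ (-β)) hx.le hs hcont
    (fun u hu => by
      have hxu : 0 < x - u := sub_pos.2 hu.1.2
      have h1 : HasDerivAt (fun u => f x - f u) (-p u) u := (hd u hu.2).const_sub _
      have h2 : HasDerivAt (fun u : ℝ => (x - u) ^ (-β)) (-1 * -β * (x - u) ^ (-β - 1)) u :=
        ((hasDerivAt_id u).const_sub x).rpow_const (Or.inl hxu.ne')
      refine (h1.mul h2).congr_deriv ?_
      rw [show -β - 1 = -(β + 1) by ring, Real.rpow_neg hxu.le (β + 1)]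
      ring)
    ((hint2.const_mul β).sub hint1)
  rw [intervalIntegral.integral_sub (hint2.const_mul β) hint1,
    intervalIntegral.integral_const_mul] at key
  simp only [sub_self, zero_mul, sub_zero, h0, zero_sub] at key
  rw [marchaud, ← sub_eq_zero, div_eq_mul_inv, ← Real.rpow_neg hx.le]
  linarith

end Kernel

/-! ### Fractional integration by parts -/

lemma integral_mul_integral_swap {a b k : ℝ → ℝ} {M : ℝ} (ha : Integrable a) (hb : Measurable b)
    (hM : ∀ v, |b v| ≤ M) (hk : Integrable k) :
    ∫ x, a x * ∫ v, b v * k (x - v) = ∫ v, b v * ∫ x, a x * k (x - v) := by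
  have h1 : Integrable (fun q : ℝ × ℝ => b q.1 * (a q.2 * k (-(q.1 - q.2))))
      (volume.prod volume) := by
    refine (ha.convolution_integrand (ContinuousLinearMap.mul ℝ ℝ) hk.comp_neg).bdd_mul
      (c := M) (hb.comp measurable_fst).aestronglyMeasurable (Eventually.of_forall fun q => hM _)
  have h2 := integral_integral_swap (f := fun v x => b v * (a x * k (-(v - x)))) h1
  simp_rw [← integral_const_mul, neg_sub] at h2 ⊢
  rw [h2]
  refine integral_congr_ae (Eventually.of_forall fun x => ?_)
  refine integral_congr_ae (Eventually.of_forall fun v => ?_)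
  simp only
  ring

/-- The power function `y ↦ y ^ s` cut off outside `(0, 1)`. -/
def powKernel (s : ℝ) : ℝ → ℝ := (Ioo (0 : ℝ) 1).indicator fun y => y ^ s

lemma measurable_powKernel (s : ℝ) : Measurable (powKernel s) :=
  Measurable.indicator (by fun_prop) measurableSet_Ioo

lemma integrable_powKernel {s : ℝ} (hs : -1 < s) : Integrable (powKernel s) := by
  rw [powKernel, integrable_indicator_iff measurableSet_Ioo]
  exact (intervalIntegral.integrableOn_Ioo_rpow_iff zero_lt_one).2 hs

lemma integral_Ioo_eq (a b : ℝ) (hab : a ≤ b) (f : ℝ → ℝ) :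
    ∫ x in a..b, f x = ∫ x, (Ioo a b).indicator f x := by
  rw [intervalIntegral.integral_of_le hab, integral_indicator measurableSet_Ioo,
    integral_Ioc_eq_integral_Ioo]

/-- Fractional integrals become convolutions on the whole line, to which the Fubini lemma above
applies. -/
lemma integral_mul_sub_rpow_eq (p : ℝ → ℝ) (s : ℝ) {x : ℝ} (hx0 : 0 ≤ x) (hx1 : x ≤ 1) :
    ∫ v in (0 : ℝ)..x, p v * (x - v) ^ s
      = ∫ v, (Ioo (0 : ℝ) 1).indicator p v * powKernel s (x - v) := by
  rw [integral_Ioo_eq _ _ hx0]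
  congr 1 with v
  simp only [powKernel, indicator, mem_Ioo]
  split_ifs <;> first | rfl | simp
  all_goals (exfalso; simp_all; linarith)

/-- This is the Beta integral `B(1 - β, β)` on an interval of length `w - v`; the two parameters sum
to `1`, so the length drops out. -/
lemma integral_rpow_mul_rpow_eq_Gamma {β : ℝ} (hβ0 : 0 < β) (hβ1 : β < 1) {v w : ℝ}
    (hvw : v < w) :
    ∫ x in v..w, (w - x) ^ (β - 1) * (x - v) ^ (-β) = Real.Gamma β * Real.Gamma (1 - β) := by
  have hL : 0 < w - v := sub_pos.2 hvw
  have h1 := intervalIntegral.integral_comp_add_right (a := (0 : ℝ)) (b := w - v)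
    (fun x => (w - x) ^ (β - 1) * (x - v) ^ (-β)) v
  simp only [zero_add, sub_add_cancel, add_sub_cancel_right] at h1
  rw [← h1, ← Complex.ofReal_inj, ← intervalIntegral.integral_ofReal]
  have h2 := Complex.betaIntegral_scaled ((1 - β : ℝ) : ℂ) (β : ℂ) hL
  have h3 := Complex.Gamma_mul_Gamma_eq_betaIntegral (s := ((1 - β : ℝ) : ℂ)) (t := (β : ℂ))
    (by simpa using hβ1) (by simpa using hβ0)
  have h4 : ((1 - β : ℝ) : ℂ) + β = 1 := by push_cast; ring
  rw [h4, sub_self, Complex.cpow_zero, one_mul] at h2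
  rw [h4, Complex.Gamma_one, one_mul, ← h2, Complex.Gamma_ofReal, Complex.Gamma_ofReal] at h3
  push_cast at h3 ⊢
  rw [mul_comm, h3]
  refine intervalIntegral.integral_congr fun x hx => ?_
  rw [uIcc_of_le hL.le] at hx
  have e1 : 0 ≤ w - (x + v) := by linarith [hx.2]
  rw [Complex.ofReal_cpow e1, Complex.ofReal_cpow hx.1]
  push_cast
  rw [mul_comm]
  congr 2
  · ring
  · ring

section Abel

variable {β M : ℝ} {p q : ℝ → ℝ}

/-- Composition of the fractional integrals of orders `β` and `1 - β`. -/
lemma integral_fractional_comp (hβ0 : 0 < β) (hβ1 : β < 1) (hp : Measurable p)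
    (hM : ∀ x, |p x| ≤ M) {w : ℝ} (hw0 : 0 ≤ w) (hw1 : w ≤ 1) :
    ∫ x in (0 : ℝ)..w, (∫ v in (0 : ℝ)..x, p v * (x - v) ^ (-β)) * (w - x) ^ (β - 1)
      = Real.Gamma β * Real.Gamma (1 - β) * ∫ v in (0 : ℝ)..w, p v := by
  have hM0 : 0 ≤ M := (abs_nonneg _).trans (hM 0)
  set P : ℝ → ℝ := (Ioo (0 : ℝ) 1).indicator p with hP
  set a : ℝ → ℝ := (Ioo (0 : ℝ) w).indicator fun x => (w - x) ^ (β - 1) with ha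
  have hPm : Measurable P := hp.indicator measurableSet_Ioo
  have hPM : ∀ v, |P v| ≤ M := fun v => by
    by_cases h : v ∈ Ioo (0 : ℝ) 1 <;> simp [hP, h, hM, hM0]
  have hai : Integrable a := by
    rw [ha, integrable_indicator_iff measurableSet_Ioo, ← integrableOn_Ioc_iff_integrableOn_Ioo,
      ← intervalIntegrable_iff_integrableOn_Ioc_of_le hw0]
    exact intervalIntegrable_sub_rpow (by linarith) w
  have hswap := integral_mul_integral_swap hai hPm hPM
    (integrable_powKernel (s := -β) (by linarith))
  have hleft : ∫ x in (0 : ℝ)..w, (∫ v in (0 : ℝ)..x, p v * (x - v) ^ (-β)) * (w - x) ^ (β - 1)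
      = ∫ x, a x * ∫ v, P v * powKernel (-β) (x - v) := by
    rw [integral_Ioo_eq _ _ hw0]
    congr 1 with x
    by_cases hx : x ∈ Ioo 0 w
    · rw [ha, indicator_of_mem hx, indicator_of_mem hx,
        integral_mul_sub_rpow_eq p (-β) hx.1.le (hx.2.le.trans hw1), mul_comm]
    · rw [ha, indicator_of_notMem hx, indicator_of_notMem hx, zero_mul]
  rw [hleft, hswap, ← intervalIntegral.integral_const_mul, integral_Ioo_eq _ _ hw0]
  congr 1 with v
  by_cases hv : v ∈ Ioo 0 w
  · have hv1 : v ∈ Ioo (0 : ℝ) 1 := ⟨hv.1, hv.2.trans_le hw1⟩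
    rw [hP, indicator_of_mem hv, indicator_of_mem hv1, mul_comm,
      ← integral_rpow_mul_rpow_eq_Gamma hβ0 hβ1 hv.2, integral_Ioo_eq _ _ hv.2.le]
    congr 2 with x
    simp only [ha, powKernel, indicator, mem_Ioo]
    rcases hv with ⟨hv0, hvw⟩
    split_ifs <;> first | rfl | simp
    all_goals (exfalso; simp_all <;> linarith)
  · rw [indicator_of_notMem hv]
    by_cases hv1 : v ∈ Ioo (0 : ℝ) 1
    · have hwv : w ≤ v := by
        by_contra h
        exact hv ⟨hv1.1, not_le.1 h⟩
      have : ∀ x, a x * powKernel (-β) (x - v) = 0 := fun x => by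
        by_cases hx : x ∈ Ioo 0 w
        · rw [powKernel, indicator_of_notMem, mul_zero]
          intro h
          linarith [h.1, hx.2]
        · rw [ha, indicator_of_notMem hx, zero_mul]
      simp [this]
    · rw [hP, indicator_of_notMem hv1, zero_mul]

/-- Fractional integration by parts. -/
lemma integral_fractional_by_parts (hβ0 : 0 < β) (hβ1 : β < 1) (hp : Measurable p)
    (hM : ∀ x, |p x| ≤ M) (hq : IntervalIntegrable q volume 0 1) :
    ∫ x in (0 : ℝ)..1, (∫ v in (0 : ℝ)..x, p v * (x - v) ^ (-β))
        * (∫ w in x..1, q w * (w - x) ^ (β - 1))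
      = Real.Gamma β * Real.Gamma (1 - β) * ∫ w in (0 : ℝ)..1, q w * ∫ v in (0 : ℝ)..w, p v := by
  have hM0 : 0 ≤ M := (abs_nonneg _).trans (hM 0)
  set P : ℝ → ℝ := (Ioo (0 : ℝ) 1).indicator p with hP
  set Q : ℝ → ℝ := (Ioo (0 : ℝ) 1).indicator q with hQ
  set K := powKernel (-β) with hK
  have hKi : Integrable K := integrable_powKernel (by linarith)
  have hKm : Measurable K := measurable_powKernel _
  have hPm : Measurable P := hp.indicator measurableSet_Ioo
  have hPM : ∀ v, |P v| ≤ M := fun v => by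
    by_cases h : v ∈ Ioo (0 : ℝ) 1 <;> simp [hP, h, hM, hM0]
  -- The inner integral is itself bounded and measurable, so it can be the bounded factor of a
  -- Fubini exchange against `q`; `integral_fractional_comp` then evaluates what is left.
  set A : ℝ → ℝ := (Ioo (0 : ℝ) 1).indicator fun x => ∫ v, P v * K (x - v) with hA
  have hAm : Measurable A := by
    refine Measurable.indicator ?_ measurableSet_Ioo
    refine (StronglyMeasurable.integral_prod_right' (ν := volume)
      (f := fun z : ℝ × ℝ => P z.2 * K (z.1 - z.2)) ?_).measurable
    exact Measurable.stronglyMeasurable (by fun_prop)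
  have hAM : ∀ x, |A x| ≤ M * ∫ y, |K y| := fun x => by
    have hnn : 0 ≤ M * ∫ y, |K y| := mul_nonneg hM0 (integral_nonneg fun _ => abs_nonneg _)
    by_cases h : x ∈ Ioo (0 : ℝ) 1
    · rw [hA, indicator_of_mem h, ← integral_sub_left_eq_self (fun y => |K y|) volume x,
        ← integral_const_mul, ← Real.norm_eq_abs]
      refine norm_integral_le_of_norm_le ((hKi.abs.comp_sub_left x).const_mul M)
        (Eventually.of_forall fun v => ?_)
      rw [Real.norm_eq_abs, abs_mul]
      gcongr
      exact hPM v
    · rwa [hA, indicator_of_notMem h, abs_zero]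
  have hQi : Integrable Q := by
    rwa [hQ, integrable_indicator_iff measurableSet_Ioo, ← integrableOn_Ioc_iff_integrableOn_Ioo,
      ← intervalIntegrable_iff_integrableOn_Ioc_of_le zero_le_one]
  have hswap := integral_mul_integral_swap hQi hAm hAM
    (integrable_powKernel (s := β - 1) (by linarith))
  have hAeq : ∀ x ∈ Ioo (0 : ℝ) 1, A x = ∫ v in (0 : ℝ)..x, p v * (x - v) ^ (-β) := fun x hx => by
    rw [hA, indicator_of_mem hx, integral_mul_sub_rpow_eq p (-β) hx.1.le hx.2.le]
  have hleft : ∫ x in (0 : ℝ)..1, (∫ v in (0 : ℝ)..x, p v * (x - v) ^ (-β))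
        * (∫ w in x..1, q w * (w - x) ^ (β - 1))
      = ∫ x, A x * ∫ w, Q w * powKernel (β - 1) (w - x) := by
    rw [integral_Ioo_eq _ _ zero_le_one]
    congr 1 with x
    by_cases hx : x ∈ Ioo (0 : ℝ) 1
    · rw [indicator_of_mem hx, hAeq x hx, integral_Ioo_eq _ _ hx.2.le]
      congr 2 with w
      simp only [hQ, powKernel, indicator, mem_Ioo]
      rcases hx with ⟨hx0, hx1⟩
      split_ifs <;> first | rfl | simp
      all_goals (exfalso; simp_all; linarith)
    · rw [hA, indicator_of_notMem hx, indicator_of_notMem hx, zero_mul]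
  rw [hleft, ← hswap, ← intervalIntegral.integral_const_mul, integral_Ioo_eq _ _ zero_le_one]
  congr 1 with w
  by_cases hw : w ∈ Ioo (0 : ℝ) 1
  · rw [hQ, indicator_of_mem hw, indicator_of_mem hw]
    have h1 := integral_fractional_comp hβ0 hβ1 hp hM hw.1.le hw.2.le
    have h2 := integral_mul_sub_rpow_eq
      (fun x => ∫ v in (0 : ℝ)..x, p v * (x - v) ^ (-β)) (β - 1) hw.1.le hw.2.le
    have h3 : (Ioo (0 : ℝ) 1).indicator (fun x => ∫ v in (0 : ℝ)..x, p v * (x - v) ^ (-β)) = A := by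
      ext x
      by_cases hx : x ∈ Ioo (0 : ℝ) 1
      · rw [indicator_of_mem hx, hAeq x hx]
      · rw [hA, indicator_of_notMem hx, indicator_of_notMem hx]
    rw [h3, h1] at h2
    rw [← h2]
    ring
  · rw [hQ, indicator_of_notMem hw, indicator_of_notMem hw, zero_mul]

end Abel

/-! ### Measurability, and the integral of Lipschitz functions -/

lemma measurable_indicator_marchaud {f : ℝ → ℝ} (hf : Measurable f) (β : ℝ) :
    Measurable ((Ioi (0 : ℝ)).indicator (marchaud β f)) := by
  have h : (Ioi (0 : ℝ)).indicator (marchaud β f) = (Ioi (0 : ℝ)).indicator fun x =>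
      f x / x ^ β + β * ∫ u, {z : ℝ × ℝ | 0 < z.2 ∧ z.2 ≤ z.1}.indicator
        (fun z => (f z.1 - f z.2) / (z.1 - z.2) ^ (β + 1)) (x, u) := by
    refine indicator_congr fun x hx => ?_
    rw [marchaud, intervalIntegral.integral_of_le (le_of_lt hx),
      ← integral_indicator measurableSet_Ioc]
    rfl
  rw [h]
  refine Measurable.indicator (Measurable.add (by fun_prop) (Measurable.const_mul ?_ _))
    measurableSet_Ioi
  refine (StronglyMeasurable.integral_prod_right' (ν := volume) ?_).measurable
  refine (Measurable.indicator (by fun_prop) ?_).stronglyMeasurable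
  exact (measurableSet_lt measurable_const measurable_snd).inter
    (measurableSet_le measurable_snd measurable_fst)

lemma aestronglyMeasurable_marchaud {f : ℝ → ℝ} (hf : Measurable f) (β : ℝ) :
    AEStronglyMeasurable (marchaud β f) (volume.restrict (Ioi 0)) := by
  refine (measurable_indicator_marchaud hf β).aestronglyMeasurable.congr ?_
  filter_upwards [ae_restrict_mem measurableSet_Ioi] with x hx
  rw [indicator_of_mem hx]

lemma aestronglyMeasurable_marchaud_reflect {f : ℝ → ℝ} (hf : Measurable f) (β : ℝ) :
    AEStronglyMeasurable (fun x => marchaud β f (1 - x)) (volume.restrict (Iio 1)) := by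
  have h : Measurable fun x => (Ioi (0 : ℝ)).indicator (marchaud β f) (1 - x) :=
    (measurable_indicator_marchaud hf β).comp (by fun_prop)
  refine h.aestronglyMeasurable.congr ?_
  filter_upwards [ae_restrict_mem measurableSet_Iio] with x hx
  rw [indicator_of_mem (mem_Ioi.2 (sub_pos.2 hx))]

/-- For Lipschitz functions the generalized integral is the Lebesgue integral `∫ f g'`. -/
lemma integral_marchaud_mul_marchaud {β C C' M M' : ℝ} {f g p q : ℝ → ℝ} {s : Set ℝ}
    (hβ0 : 0 < β) (hβ1 : β < 1)
    (hf : IsHolder C 1 f) (h0 : f 0 = 0) (hs : s.Countable) (hd : ∀ x ∉ s, HasDerivAt f (p x) x)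
    (hp : Measurable p) (hM : ∀ x, |p x| ≤ M)
    (hg : IsHolder C' 1 g) (hgd : ∀ x, HasDerivAt g (q x) x) (hq : Continuous q)
    (hM' : ∀ x, |q x| ≤ M') :
    ∫ x in (0 : ℝ)..1, marchaud β f x * marchaud (1 - β) (reflect g) (1 - x)
      = -(Real.Gamma β * Real.Gamma (1 - β) * ∫ w in (0 : ℝ)..1, q w * f w) := by
  have hpi : ∀ a b : ℝ, IntervalIntegrable p volume a b := fun a b =>
    (intervalIntegrable_const (c := M)).mono_fun' hp.aestronglyMeasurable
      (Eventually.of_forall hM)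
  have hfw : ∀ w ∈ uIcc (0 : ℝ) 1, q w * f w = q w * ∫ v in (0 : ℝ)..w, p v := fun w hw => by
    rw [uIcc_of_le zero_le_one] at hw
    rw [integral_eq_of_hasDerivAt_off_countable_of_le f p hw.1 hs
      (hf.continuous one_pos).continuousOn (fun x hx => hd x hx.2) (hpi 0 w), h0, sub_zero]
  have hgm : ∀ x < 1, marchaud (1 - β) (reflect g) (1 - x)
      = -∫ w in x..1, q w * (w - x) ^ (β - 1) := fun x hx => by
    rw [marchaud_eq_integral_deriv (p := fun y => -q (1 - y)) (M := M') hg.reflect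
      (reflect_zero g) countable_empty (fun y _ => ?_) (by fun_prop)
      (fun y => by rw [abs_neg]; exact hM' _) (by linarith) (sub_pos.2 hx)]
    · have := intervalIntegral.integral_comp_sub_left (a := (0 : ℝ)) (b := 1 - x)
        (fun w => q w * (w - x) ^ (β - 1)) 1
      simp only [sub_sub_cancel, sub_zero] at this
      rw [← this, ← intervalIntegral.integral_neg]
      refine intervalIntegral.integral_congr fun v _ => ?_
      simp only [neg_mul, neg_inj]
      congr 2 <;> ring
    · have h1 := (hgd (1 - y)).comp y ((hasDerivAt_id y).const_sub 1)
      exact (h1.sub_const (g 1)).congr_deriv (by ring)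
  rw [intervalIntegral.integral_congr hfw,
    ← integral_fractional_by_parts hβ0 hβ1 hp hM (hq.intervalIntegrable 0 1),
    ← intervalIntegral.integral_neg]
  rw [integral_Ioo_eq _ _ zero_le_one, integral_Ioo_eq _ _ zero_le_one]
  congr 1
  refine indicator_congr fun x hx => ?_
  rw [hgm x hx.2, marchaud_eq_integral_deriv hf h0 hs hd hp hM hβ1 hx.1, mul_neg]

/-! ### Steklov averages -/

/-- The average of `g` over `[x, x + η]`. -/
def steklov (η : ℝ) (g : ℝ → ℝ) (x : ℝ) : ℝ := ∫ u in (0 : ℝ)..1, g (x + η * u)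

section Steklov

variable {C r η : ℝ} {g : ℝ → ℝ}

/-- An average of translates keeps the Hölder constant. That it is the same for all `η` is what
makes the passage to the limit dominated. -/
lemma IsHolder.steklov (hg : IsHolder C r g) (hr : 0 < r) : IsHolder C r (steklov η g) := by
  intro s t
  have hc := hg.continuous hr
  rw [GLS.steklov, GLS.steklov, ← intervalIntegral.integral_sub
    (Continuous.intervalIntegrable (by fun_prop) _ _)
    (Continuous.intervalIntegrable (by fun_prop) _ _)]
  have := intervalIntegral.norm_integral_le_of_norm_le_const (a := (0 : ℝ)) (b := 1)
    (f := fun u => g (t + η * u) - g (s + η * u)) (C := C * |t - s| ^ r) fun u _ => by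
      have h := hg (s + η * u) (t + η * u)
      rwa [add_sub_add_right_eq_sub] at h
  simpa using this

lemma IsHolder.hasDerivAt_steklov (hg : IsHolder C r g) (hr : 0 < r) (hη : 0 < η) (x : ℝ) :
    HasDerivAt (GLS.steklov η g) (η⁻¹ * (g (x + η) - g x)) x := by
  have hc := hg.continuous hr
  have h : GLS.steklov η g
      = fun x => η⁻¹ * ((∫ u in (0 : ℝ)..(x + η), g u) - ∫ u in (0 : ℝ)..x, g u) := by
    ext y
    rw [GLS.steklov, intervalIntegral.integral_comp_add_mul g hη.ne' y,
      intervalIntegral.integral_interval_sub_left (hc.intervalIntegrable _ _)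
        (hc.intervalIntegrable _ _)]
    simp
  have hG : ∀ y, HasDerivAt (fun x => ∫ u in (0 : ℝ)..x, g u) (g y) y := fun y =>
    intervalIntegral.integral_hasDerivAt_right (hc.intervalIntegrable _ _)
      (hc.stronglyMeasurableAtFilter _ _) hc.continuousAt
  rw [h]
  exact (((hG (x + η)).comp_add_const x η).sub (hG x)).const_mul _

lemma IsHolder.tendsto_steklov (hg : IsHolder C r g) (hr : 0 < r) (x : ℝ) :
    Tendsto (fun n : ℕ => GLS.steklov (1 / ((n : ℝ) + 1)) g x) atTop (𝓝 (g x)) := by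
  have hc := hg.continuous hr
  have hη : Tendsto (fun n : ℕ => 1 / ((n : ℝ) + 1)) atTop (𝓝 0) :=
    tendsto_one_div_add_atTop_nhds_zero_nat
  have hcont : Continuous fun η => GLS.steklov η g x := by
    unfold GLS.steklov
    exact intervalIntegral.continuous_parametric_intervalIntegral_of_continuous' (by fun_prop) _ _
  have := (hcont.tendsto 0).comp hη
  simpa [GLS.steklov, Function.comp_def] using this

end Steklov

lemma isHolder_one_of_hasDerivAt {g q : ℝ → ℝ} {M : ℝ} (hd : ∀ x, HasDerivAt g (q x) x)
    (hM : ∀ x, |q x| ≤ M) : IsHolder M 1 g := by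
  intro s t
  rw [Real.rpow_one]
  exact convex_univ.norm_image_sub_le_of_norm_hasDerivWithin_le
    (fun x _ => (hd x).hasDerivWithinAt) (fun x _ => hM x) (mem_univ s) (mem_univ t)

/-! ### Frozen integrands and their chain rule -/

/-- The point of `[c, d]` closest to `s`. -/
def clamp (c d s : ℝ) : ℝ := max c (min d s)

lemma abs_clamp_sub_le (c d s t : ℝ) : |clamp c d t - clamp c d s| ≤ |t - s| := by
  unfold clamp
  calc _ ≤ |min d t - min d s| := by
        simpa using abs_max_sub_max_le_max c (min d t) c (min d s)
    _ ≤ |t - s| := by simpa using abs_min_sub_min_le_max d t d s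

lemma continuous_clamp (c d : ℝ) : Continuous (clamp c d) := by unfold clamp; fun_prop

lemma clamp_of_le {c d s : ℝ} (h : s ≤ c) (hcd : c ≤ d) : clamp c d s = c := by
  rw [clamp, min_eq_right (h.trans hcd), max_eq_left h]

lemma clamp_of_ge {c d s : ℝ} (h : d ≤ s) (hcd : c ≤ d) : clamp c d s = d := by
  rw [clamp, min_eq_left h, max_eq_right hcd]

lemma clamp_of_mem {c d s : ℝ} (h1 : c ≤ s) (h2 : s ≤ d) : clamp c d s = s := by
  rw [clamp, min_eq_right h2, max_eq_right h1]

/-- The integrand `h (g - g c)`, started at time `c` and frozen at time `d`. -/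
def frozen (h g : ℝ → ℝ) (c d s : ℝ) : ℝ := h (g (clamp c d s) - g c)

section Frozen

variable {C r Λ c d β : ℝ} {h h' K g q : ℝ → ℝ}

lemma IsHolder.frozen (hg : IsHolder C r g) (hr : 0 ≤ r) (hh : IsHolder Λ 1 h) :
    IsHolder (Λ * C) r (frozen h g c d) := by
  intro s t
  have h1 := hh (g (clamp c d s) - g c) (g (clamp c d t) - g c)
  rw [Real.rpow_one, sub_sub_sub_cancel_right] at h1
  refine h1.trans ?_
  rw [mul_assoc]
  refine mul_le_mul_of_nonneg_left ((hg _ _).trans ?_) hh.nonneg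
  exact mul_le_mul_of_nonneg_left
    (Real.rpow_le_rpow (abs_nonneg _) (abs_clamp_sub_le _ _ _ _) hr) hg.nonneg

lemma frozen_of_le (hcd : c ≤ d) (h0 : h 0 = 0) {s : ℝ} (hs : s ≤ c) :
    frozen h g c d s = 0 := by
  rw [frozen, clamp_of_le hs hcd, sub_self, h0]

lemma clamp_cases (hcd : c ≤ d) {x : ℝ} (hx : x ∉ ({c, d} : Set ℝ)) :
    (x < c ∧ clamp c d =ᶠ[𝓝 x] fun _ => c) ∨ (x ∈ Ioo c d ∧ clamp c d =ᶠ[𝓝 x] id) ∨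
      (d < x ∧ clamp c d =ᶠ[𝓝 x] fun _ => d) := by
  simp only [mem_insert_iff, mem_singleton_iff, not_or] at hx
  rcases lt_or_gt_of_ne hx.1 with h1 | h1
  · left
    refine ⟨h1, ?_⟩
    filter_upwards [Iio_mem_nhds h1] with y hy
    exact clamp_of_le (le_of_lt hy) hcd
  · right
    rcases lt_or_gt_of_ne hx.2 with h2 | h2
    · left
      refine ⟨⟨h1, h2⟩, ?_⟩
      filter_upwards [Ioo_mem_nhds h1 h2] with y hy
      exact clamp_of_mem hy.1.le hy.2.le
    · right
      refine ⟨h2, ?_⟩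
      filter_upwards [Ioi_mem_nhds h2] with y hy
      exact clamp_of_ge (le_of_lt hy) hcd

lemma hasDerivAt_frozen (hcd : c ≤ d) (hh : ∀ x, HasDerivAt h (h' x) x)
    (hgd : ∀ x, HasDerivAt g (q x) x) {x : ℝ} (hx : x ∉ ({c, d} : Set ℝ)) :
    HasDerivAt (frozen h g c d) ((Ioo c d).indicator (fun x => h' (g x - g c) * q x) x) x := by
  rcases clamp_cases hcd hx with ⟨h1, h2⟩ | ⟨h1, h2⟩ | ⟨h1, h2⟩
  · rw [indicator_of_notMem fun hm => h1.not_gt hm.1]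
    refine (hasDerivAt_const x (h (g c - g c))).congr_of_eventuallyEq ?_
    filter_upwards [h2] with y hy
    rw [frozen, hy]
  · rw [indicator_of_mem h1]
    refine ((hh _).comp x ((hgd x).sub_const (g c))).congr_of_eventuallyEq ?_
    filter_upwards [h2] with y hy
    rw [frozen, hy]
    rfl
  · rw [indicator_of_notMem fun hm => h1.not_gt hm.2]
    refine (hasDerivAt_const x (h (g d - g c))).congr_of_eventuallyEq ?_
    filter_upwards [h2] with y hy
    rw [frozen, hy]

/-- One explicit primitive covers all three regimes: it is `0` before `c`, `K (g - g c)` on `[c,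
d]`, and affine in `g` with slope `h (g d - g c)` after `d`. -/
lemma integral_mul_frozen (hc : 0 ≤ c) (hcd : c ≤ d) (hd : d ≤ 1)
    (hK : ∀ x, HasDerivAt K (h x) x) (hh : Continuous h) (h0 : h 0 = 0) (hK0 : K 0 = 0)
    (hgd : ∀ x, HasDerivAt g (q x) x) (hq : Continuous q) :
    ∫ w in (0 : ℝ)..1, q w * frozen h g c d w
      = K (g d - g c) + h (g d - g c) * (g 1 - g d) := by
  have hgc : Continuous g := continuous_iff_continuousAt.2 fun x => (hgd x).continuousAt
  have hKc : Continuous K := continuous_iff_continuousAt.2 fun x => (hK x).continuousAt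
  have hcl := continuous_clamp c d
  have key := integral_eq_of_hasDerivAt_off_countable_of_le
    (fun s => K (g (clamp c d s) - g c) + h (g (clamp c d s) - g c) * (g s - g (clamp c d s)))
    (fun w => q w * frozen h g c d w) (zero_le_one (α := ℝ))
    (s := {c, d}) (Set.toFinite _).countable (Continuous.continuousOn (by fun_prop))
    (fun x hx => by
      rcases clamp_cases hcd hx.2 with ⟨h1, h2⟩ | ⟨h1, h2⟩ | ⟨h1, h2⟩
      · rw [frozen_of_le hcd h0 h1.le, mul_zero]
        refine (hasDerivAt_const x (0 : ℝ)).congr_of_eventuallyEq ?_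
        filter_upwards [h2] with y hy
        rw [hy, sub_self, hK0, h0, zero_add, zero_mul]
      · refine (((hK _).comp x ((hgd x).sub_const (g c))).congr_of_eventuallyEq ?_).congr_deriv ?_
        · filter_upwards [h2] with y hy
          rw [hy, id, sub_self, mul_zero, add_zero]
          rfl
        · rw [frozen, clamp_of_mem h1.1.le h1.2.le, mul_comm]
      · refine (((((hgd x).sub_const (g d)).const_mul (h (g d - g c))).const_add
          (K (g d - g c))).congr_of_eventuallyEq ?_).congr_deriv ?_
        · filter_upwards [h2] with y hy
          rw [hy]
        · rw [frozen, clamp_of_ge h1.le hcd, mul_comm])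
    (Continuous.intervalIntegrable (by unfold frozen; fun_prop) _ _)
  rw [key, clamp_of_ge hd hcd, clamp_of_le hc hcd]
  simp [hK0, h0]

/-- Chain rule for the frozen integrand, in terms of Marchaud derivatives. -/
lemma integral_marchaud_frozen (hβ0 : 0 < β) (hβ1 : β < 1) (hβr : β < r) (hβr' : 1 - β < r)
    (hg : IsHolder C r g) (hc : 0 ≤ c) (hcd : c ≤ d) (hd : d ≤ 1)
    (hK : ∀ x, HasDerivAt K (h x) x) (hh : ∀ x, HasDerivAt h (h' x) x) (hh' : Continuous h')
    (hΛ : ∀ x, |h' x| ≤ Λ) (h0 : h 0 = 0) (hK0 : K 0 = 0) :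
    ∫ x in (0 : ℝ)..1, marchaud β (frozen h g c d) x * marchaud (1 - β) (reflect g) (1 - x)
      = -(Real.Gamma β * Real.Gamma (1 - β)
          * (K (g d - g c) + h (g d - g c) * (g 1 - g d))) := by
  have hr : 0 < r := hβ0.trans hβr
  have hhc : Continuous h := continuous_iff_continuousAt.2 fun x => (hh x).continuousAt
  have hKc : Continuous K := continuous_iff_continuousAt.2 fun x => (hK x).continuousAt
  have hhL : IsHolder Λ 1 h := isHolder_one_of_hasDerivAt hh hΛ
  set G : ℕ → ℝ → ℝ := fun n => steklov (1 / ((n : ℝ) + 1)) g with hG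
  have hGh : ∀ n, IsHolder C r (G n) := fun n => hg.steklov hr
  have hGlim : ∀ x, Tendsto (fun n => G n x) atTop (𝓝 (g x)) := fun x => hg.tendsto_steklov hr x
  have hFlim : ∀ x, Tendsto (fun n => frozen h (G n) c d x) atTop (𝓝 (frozen h g c d x)) :=
    fun x => (hhc.tendsto _).comp ((hGlim _).sub (hGlim _))
  have hRlim : ∀ x, Tendsto (fun n => reflect (G n) x) atTop (𝓝 (reflect g x)) :=
    fun x => (hGlim _).sub (hGlim _)
  have hval : ∀ n, ∫ x in (0 : ℝ)..1, marchaud β (frozen h (G n) c d) x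
        * marchaud (1 - β) (reflect (G n)) (1 - x)
      = -(Real.Gamma β * Real.Gamma (1 - β)
          * (K (G n d - G n c) + h (G n d - G n c) * (G n 1 - G n d))) := fun n => by
    set η : ℝ := 1 / ((n : ℝ) + 1) with hηdef
    have hη : 0 < η := by positivity
    have hgd : ∀ x, HasDerivAt (G n) (η⁻¹ * (g (x + η) - g x)) x :=
      fun x => hg.hasDerivAt_steklov hr hη x
    have hgc := hg.continuous hr
    have hq : Continuous fun x => η⁻¹ * (g (x + η) - g x) := by fun_prop
    -- This Lipschitz constant may blow up as `η → 0`. It serves only the identity at fixed `n`; the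
    -- limit relies on the uniform bounds `hGh`.
    have hqM : ∀ x, |η⁻¹ * (g (x + η) - g x)| ≤ η⁻¹ * (C * η ^ r) := fun x => by
      rw [abs_mul, abs_of_pos (inv_pos.2 hη)]
      gcongr
      simpa [abs_of_pos hη] using hg x (x + η)
    have hGL := isHolder_one_of_hasDerivAt hgd hqM
    have hM0 : 0 ≤ η⁻¹ * (C * η ^ r) := hGL.nonneg
    have hGc : Continuous (G n) := hGL.continuous one_pos
    rw [integral_marchaud_mul_marchaud hβ0 hβ1 (hGL.frozen zero_le_one hhL)
      (frozen_of_le hcd h0 hc) (Set.toFinite {c, d}).countable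
      (fun x hx => hasDerivAt_frozen hcd hh hgd hx)
      (Measurable.indicator (Continuous.measurable (by fun_prop)) measurableSet_Ioo)
      (M := Λ * (η⁻¹ * (C * η ^ r))) (fun x => ?_) hGL hgd hq hqM,
      integral_mul_frozen hc hcd hd hK hhc h0 hK0 hgd hq]
    by_cases hx : x ∈ Ioo c d
    · rw [indicator_of_mem hx, abs_mul]
      exact mul_le_mul (hΛ _) (hqM _) (abs_nonneg _) hhL.nonneg
    · rw [indicator_of_notMem hx, abs_zero]
      exact mul_nonneg hhL.nonneg hM0
  have hlim1 : Tendsto (fun n => ∫ x in (0 : ℝ)..1, marchaud β (frozen h (G n) c d) x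
        * marchaud (1 - β) (reflect (G n)) (1 - x)) atTop
      (𝓝 (∫ x in (0 : ℝ)..1, marchaud β (frozen h g c d) x
        * marchaud (1 - β) (reflect g) (1 - x))) := by
    rw [funext fun n => integral_Ioo_eq _ _ zero_le_one _, integral_Ioo_eq _ _ zero_le_one]
    simp_rw [integral_indicator measurableSet_Ioo]
    refine tendsto_integral_of_dominated_convergence
      (fun _ => Λ * C * (1 + β / (r - β)) * (C * (1 + (1 - β) / (r - (1 - β)))))
      (fun n => ?_) (integrable_const _) (fun n => ?_) ?_
    · refine AEStronglyMeasurable.mul ?_ ?_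
      · exact (aestronglyMeasurable_marchaud
          ((hGh n).frozen hr.le hhL |>.continuous hr).measurable β).mono_set Ioo_subset_Ioi_self
      · exact (aestronglyMeasurable_marchaud_reflect
          ((hGh n).reflect.continuous hr).measurable (1 - β)).mono_set Ioo_subset_Iio_self
    · filter_upwards [ae_restrict_mem measurableSet_Ioo] with x hx
      rw [Real.norm_eq_abs, abs_mul]
      have b1 := ((hGh n).frozen (c := c) (d := d) hr.le hhL).abs_marchaud_le hβ0 hβr
        (frozen_of_le hcd h0 hc) hx.1 hx.2.le
      have b2 := (hGh n).reflect.abs_marchaud_le (β := 1 - β) (by linarith) hβr' (reflect_zero _)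
        (x := 1 - x) (by linarith [hx.2]) (by linarith [hx.1])
      exact mul_le_mul b1 b2 (abs_nonneg _) ((abs_nonneg _).trans b1)
    · filter_upwards [ae_restrict_mem measurableSet_Ioo] with x hx
      exact (tendsto_marchaud (fun n => (hGh n).frozen hr.le hhL) hr hβr hFlim hx.1).mul
        (tendsto_marchaud (fun n => (hGh n).reflect) hr hβr' hRlim (sub_pos.2 hx.2))
  have hlim2 : Tendsto (fun n => -(Real.Gamma β * Real.Gamma (1 - β)
          * (K (G n d - G n c) + h (G n d - G n c) * (G n 1 - G n d)))) atTop
      (𝓝 (-(Real.Gamma β * Real.Gamma (1 - β)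
          * (K (g d - g c) + h (g d - g c) * (g 1 - g d))))) := by
    have hdc := (hGlim d).sub (hGlim c)
    exact ((((hKc.tendsto _).comp hdc).add (((hhc.tendsto _).comp hdc).mul
      ((hGlim 1).sub (hGlim d)))).const_mul _).neg
  rw [funext hval] at hlim1
  exact tendsto_nhds_unique hlim1 hlim2

end Frozen

/-! ### The fractional norm and existence of the integral -/

/-- The integrand of `fracNorm β 0 1 f`. -/
def fracDensity (β : ℝ) (f : ℝ → ℝ) (t : ℝ) : ℝ≥0∞ :=
  ENNReal.ofReal (|f t| / t ^ β)
    + ∫⁻ s in Icc 0 t, ENNReal.ofReal (|f t - f s| / (t - s) ^ (β + 1))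

lemma fracNorm_eq (β : ℝ) (f : ℝ → ℝ) :
    fracNorm β 0 1 f = ∫⁻ t in Icc 0 1, fracDensity β f t := by
  simp [fracNorm, fracDensity]

lemma measurable_fracDensity {f : ℝ → ℝ} (hf : Measurable f) (β : ℝ) :
    Measurable (fracDensity β f) := by
  have h : (fun t => ∫⁻ s in Icc 0 t, ENNReal.ofReal (|f t - f s| / (t - s) ^ (β + 1)))
      = fun t => ∫⁻ s, {z : ℝ × ℝ | 0 ≤ z.2 ∧ z.2 ≤ z.1}.indicator
        (fun z => ENNReal.ofReal (|f z.1 - f z.2| / (z.1 - z.2) ^ (β + 1))) (t, s) := by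
    ext t
    rw [← lintegral_indicator measurableSet_Icc]
    rfl
  have h1 : Measurable fun t => ENNReal.ofReal (|f t| / t ^ β) := by fun_prop
  refine h1.add ?_
  rw [h]
  refine Measurable.lintegral_prod_right' (ν := volume) (Measurable.indicator (by fun_prop) ?_)
  exact (measurableSet_le measurable_const measurable_snd).inter
    (measurableSet_le measurable_snd measurable_fst)

lemma lintegral_enorm_kernel (β : ℝ) (f : ℝ → ℝ) (t : ℝ) :
    ∫⁻ s in Ioc 0 t, ‖(f t - f s) / (t - s) ^ (β + 1)‖ₑ
      = ∫⁻ s in Icc 0 t, ENNReal.ofReal (|f t - f s| / (t - s) ^ (β + 1)) := by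
  rw [setLIntegral_congr Ioc_ae_eq_Icc]
  refine setLIntegral_congr_fun measurableSet_Icc fun s hs => ?_
  rw [Real.enorm_eq_ofReal_abs, abs_div,
    abs_of_nonneg (Real.rpow_nonneg (sub_nonneg.2 hs.2) _)]

lemma enorm_marchaud_le {β : ℝ} (hβ0 : 0 < β) (hβ1 : β < 1) (f : ℝ → ℝ) {t : ℝ} (ht : 0 < t) :
    ‖marchaud β f t‖ₑ ≤ fracDensity β f t := by
  refine (enorm_add_le _ _).trans (add_le_add ?_ ?_)
  · rw [Real.enorm_eq_ofReal_abs, abs_div, abs_of_pos (Real.rpow_pos_of_pos ht β)]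
  · rw [enorm_mul, ← lintegral_enorm_kernel, intervalIntegral.integral_of_le ht.le]
    refine (mul_le_mul' (b := 1) ?_ (enorm_integral_le_lintegral_enorm _)).trans (one_mul _).le
    rw [Real.enorm_eq_ofReal_abs, abs_of_pos hβ0]
    exact ENNReal.ofReal_le_one.2 hβ1.le

lemma integrableOn_kernel {β : ℝ} {f : ℝ → ℝ} (hf : Measurable f) {t : ℝ}
    (h : fracDensity β f t < ∞) :
    IntegrableOn (fun u => (f t - f u) / (t - u) ^ (β + 1)) (Ioc 0 t) := by
  refine ⟨(measurable_kernel hf t).aestronglyMeasurable, ?_⟩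
  rw [HasFiniteIntegral, lintegral_enorm_kernel]
  exact lt_of_le_of_lt le_add_self h

lemma restrict_Ioo_eq_Icc :
    (volume.restrict (Ioo (0 : ℝ) 1)) = volume.restrict (Icc (0 : ℝ) 1) :=
  Measure.restrict_congr_set Ioo_ae_eq_Icc

lemma integrable_marchaud {β : ℝ} (hβ0 : 0 < β) (hβ1 : β < 1) {f : ℝ → ℝ} (hf : Measurable f)
    (h : fracNorm β 0 1 f < ∞) : IntegrableOn (marchaud β f) (Ioo 0 1) := by
  refine ⟨(aestronglyMeasurable_marchaud hf β).mono_set Ioo_subset_Ioi_self, ?_⟩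
  rw [fracNorm_eq, ← restrict_Ioo_eq_Icc] at h
  refine lt_of_le_of_lt (setLIntegral_mono' measurableSet_Ioo fun x hx => ?_) h
  exact enorm_marchaud_le hβ0 hβ1 f hx.1

/-- The two phases multiply to `e^{iπ} = -1`, so the value is real. The sign cancels the one
produced by the reflection of `g`. -/
lemma value_eq {β : ℝ} (f g : ℝ → ℝ) :
    Complex.exp (Complex.I * Real.pi * β) *
      ∫ x in (0 : ℝ)..1, (leftDeriv β 0 f x : ℂ) * rightDeriv β 1 (fun x => g x - g 1) x
      = ((-(1 / (Real.Gamma β * Real.Gamma (1 - β)) *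
        ∫ x in (0 : ℝ)..1, marchaud β f x * marchaud (1 - β) (reflect g) (1 - x)) : ℝ) : ℂ) := by
  have h : ∀ x, (leftDeriv β 0 f x : ℂ) * rightDeriv β 1 (fun x => g x - g 1) x
      = Complex.exp (Complex.I * Real.pi * (1 - β)) / (Real.Gamma β * Real.Gamma (1 - β) : ℝ)
        * ((marchaud β f x * marchaud (1 - β) (reflect g) (1 - x) : ℝ) : ℂ) := fun x => by
    rw [leftDeriv_eq_marchaud, rightDeriv_eq_marchaud]
    push_cast
    ring
  simp_rw [h]
  rw [intervalIntegral.integral_const_mul, intervalIntegral.integral_ofReal, ← mul_assoc,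
    ← mul_div_assoc, ← Complex.exp_add,
    show Complex.I * Real.pi * β + Complex.I * Real.pi * (1 - β) = Real.pi * Complex.I by ring,
    Complex.exp_pi_mul_I]
  push_cast
  ring

/-- The generalized integral exists for measurable integrands of finite norm and Hölder
integrators. -/
lemma hasIntegral_of_fracNorm {β C r J : ℝ} {f g : ℝ → ℝ} (hβ0 : 0 < β) (hβ1 : β < 1)
    (hβr : 1 - β < r) (hf : Measurable f) (hfn : fracNorm β 0 1 f < ∞) (hg : IsHolder C r g)
    (hJ : ∫ x in (0 : ℝ)..1, marchaud β f x * marchaud (1 - β) (reflect g) (1 - x)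
      = -(Real.Gamma β * Real.Gamma (1 - β) * J)) :
    HasIntegral β 0 1 f g J := by
  have hr : 0 < r := by linarith
  have hfin : ∀ᵐ x ∂volume.restrict (Icc (0 : ℝ) 1), fracDensity β f x < ∞ := by
    refine ae_lt_top (measurable_fracDensity hf β) ?_
    rw [← fracNorm_eq]
    exact hfn.ne
  have hΓ1 := Real.Gamma_pos_of_pos hβ0
  have hΓ2 := Real.Gamma_pos_of_pos (sub_pos.2 hβ1)
  refine ⟨hf.aemeasurable, hfn, ?_, ?_, ?_, ?_, ?_⟩
  · filter_upwards [hfin, ae_restrict_mem measurableSet_Icc] with x hx hx01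
    rw [intervalIntegrable_iff_integrableOn_Ioc_of_le hx01.1]
    exact integrableOn_kernel hf hx
  · rw [memLp_one_iff_integrable, ← restrict_Ioo_eq_Icc]
    refine ((integrable_marchaud hβ0 hβ1 hf hfn).const_mul (1 / Real.Gamma (1 - β))).congr
      (Eventually.of_forall fun x => ?_)
    exact (leftDeriv_eq_marchaud β f x).symm
  · rw [← restrict_Ioo_eq_Icc]
    filter_upwards [ae_restrict_mem measurableSet_Ioo] with x hx
    have h := (hg.reflect.intervalIntegrable_kernel (β := 1 - β) hr hβr
      (sub_pos.2 hx.2)).comp_sub_left 1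
    simp only [sub_zero, sub_sub_cancel] at h
    refine h.symm.congr (fun u _ => ?_)
    simp only [reflect, sub_sub_cancel, sub_sub_sub_cancel_right]
    congr 2 <;> ring
  · rw [← restrict_Ioo_eq_Icc]
    have hm : AEStronglyMeasurable (fun x => marchaud (1 - β) (reflect g) (1 - x))
        (volume.restrict (Ioo (0 : ℝ) 1)) := (aestronglyMeasurable_marchaud_reflect
          (hg.reflect.continuous hr).measurable (1 - β)).mono_set Ioo_subset_Iio_self
    have hb : MemLp (fun x => marchaud (1 - β) (reflect g) (1 - x)) ∞
        (volume.restrict (Ioo (0 : ℝ) 1)) := by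
      refine memLp_top_of_bound hm (C * (1 + (1 - β) / (r - (1 - β)))) ?_
      filter_upwards [ae_restrict_mem measurableSet_Ioo] with x hx
      exact hg.reflect.abs_marchaud_le (by linarith) hβr (reflect_zero g)
        (by linarith [hx.2]) (by linarith [hx.1])
    refine (hb.ofReal.const_mul
      (Complex.exp (Complex.I * Real.pi * (1 - β)) / (Real.Gamma β : ℂ))).congr_norm ?_ ?_
    · rw [funext (rightDeriv_eq_marchaud β g)]
      exact (Complex.continuous_ofReal.comp_aestronglyMeasurable hm).const_mul _
    · exact Eventually.of_forall fun x => by rw [rightDeriv_eq_marchaud β g]; rfl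
  · rw [value_eq, hJ]
    congr 1
    field_simp

/-- Series of integrands: the generalized integral commutes with sums that converge absolutely in
the norm `fracNorm`. -/
lemma hasIntegral_of_hasSum {β C r : ℝ} {f g : ℝ → ℝ} {F : ℕ → ℝ → ℝ} {J : ℕ → ℝ}
    (hβ0 : 0 < β) (hβ1 : β < 1) (hβr : 1 - β < r) (hf : Measurable f)
    (hF : ∀ n, Measurable (F n)) (hg : IsHolder C r g)
    (hsum : ∀ x ∈ Ico (0 : ℝ) 1, HasSum (fun n => F n x) (f x))
    (hnorm : ∑' n, fracNorm β 0 1 (F n) ≠ ∞)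
    (hJ : ∀ n, ∫ x in (0 : ℝ)..1, marchaud β (F n) x * marchaud (1 - β) (reflect g) (1 - x)
      = -(Real.Gamma β * Real.Gamma (1 - β) * J n)) :
    ∃ j, HasSum J j ∧ HasIntegral β 0 1 f g j := by
  have hr : 0 < r := by linarith
  have hΓ1 := Real.Gamma_pos_of_pos hβ0
  have hΓ2 := Real.Gamma_pos_of_pos (sub_pos.2 hβ1)
  have hFn : ∀ n, fracNorm β 0 1 (F n) < ∞ := fun n =>
    lt_of_le_of_lt (ENNReal.le_tsum n) hnorm.lt_top
  have htsum : ∑' n, fracNorm β 0 1 (F n)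
      = ∫⁻ t in Ioo (0 : ℝ) 1, ∑' n, fracDensity β (F n) t := by
    rw [lintegral_tsum fun n => (measurable_fracDensity (hF n) β).aemeasurable,
      restrict_Ioo_eq_Icc]
    simp_rw [fracNorm_eq]
  -- Countable subadditivity of the density: the triangle inequality is applied to values and to
  -- increments.
  have hle : ∀ t ∈ Ioo (0 : ℝ) 1, fracDensity β f t ≤ ∑' n, fracDensity β (F n) t := fun t ht => by
    have hft := hsum t ⟨ht.1.le, ht.2⟩
    unfold fracDensity
    rw [ENNReal.tsum_add, ← lintegral_tsum fun n => Measurable.aemeasurable (by fun_prop)]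
    refine add_le_add ?_ (setLIntegral_mono' measurableSet_Icc fun s hs => ?_)
    · have hp := Real.rpow_pos_of_pos ht.1 β
      have h := (hft.div_const (t ^ β)).tsum_eq ▸
        enorm_tsum_le_tsum_enorm (f := fun n => F n t / t ^ β)
      simpa only [Real.enorm_eq_ofReal_abs, abs_div, abs_of_pos hp] using h
    · have hp : 0 ≤ (t - s) ^ (β + 1) := Real.rpow_nonneg (sub_nonneg.2 hs.2) _
      have h := ((hft.sub (hsum s ⟨hs.1, hs.2.trans_lt ht.2⟩)).div_const
        ((t - s) ^ (β + 1))).tsum_eq ▸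
        enorm_tsum_le_tsum_enorm (f := fun n => (F n t - F n s) / (t - s) ^ (β + 1))
      simpa only [Real.enorm_eq_ofReal_abs, abs_div, abs_of_nonneg hp] using h
  have hfn : fracNorm β 0 1 f < ∞ := by
    rw [fracNorm_eq, ← restrict_Ioo_eq_Icc]
    refine lt_of_le_of_lt (setLIntegral_mono' measurableSet_Ioo hle) ?_
    rw [← htsum]
    exact hnorm.lt_top
  have hfin : ∀ᵐ t ∂volume.restrict (Ioo (0 : ℝ) 1), ∑' n, fracDensity β (F n) t < ∞ := by
    refine ae_lt_top (Measurable.tsum fun n => measurable_fracDensity (hF n) β) ?_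
    rwa [← htsum]
  -- Wherever the summed density is finite, the kernels are absolutely summable in `L_1`, so the
  -- inner integral commutes with the sum.
  have hM : ∀ᵐ t ∂volume.restrict (Ioo (0 : ℝ) 1),
      HasSum (fun n => marchaud β (F n) t) (marchaud β f t) := by
    filter_upwards [hfin, ae_restrict_mem measurableSet_Ioo] with t ht htm
    have hft := hsum t ⟨htm.1.le, htm.2⟩
    refine (hft.div_const _).add (HasSum.mul_left β ?_)
    simp_rw [intervalIntegral.integral_of_le htm.1.le]
    have hd : ∀ n, fracDensity β (F n) t < ∞ := fun n =>
      lt_of_le_of_lt (ENNReal.le_tsum n) ht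
    have hs := hasSum_integral_of_summable_integral_norm (μ := volume.restrict (Ioc 0 t))
      (F := fun n u => (F n t - F n u) / (t - u) ^ (β + 1))
      (fun n => integrableOn_kernel (hF n) (hd n)) ?_
    · have he : ∫ u in Ioc 0 t, ∑' n, (F n t - F n u) / (t - u) ^ (β + 1)
          = ∫ u in Ioc 0 t, (f t - f u) / (t - u) ^ (β + 1) :=
        setIntegral_congr_fun measurableSet_Ioc fun u hu =>
          ((hft.sub (hsum u ⟨hu.1.le, hu.2.trans_lt htm.2⟩)).div_const _).tsum_eq
      rwa [he] at hs
    · refine Summable.of_nonneg_of_le (fun n => integral_nonneg fun _ => norm_nonneg _)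
        (f := fun n => (fracDensity β (F n) t).toReal)
        (fun n => ?_) (ENNReal.summable_toReal ht.ne)
      rw [integral_norm_eq_lintegral_enorm (measurable_kernel (hF n) t).aestronglyMeasurable]
      refine ENNReal.toReal_mono (hd n).ne ?_
      rw [lintegral_enorm_kernel]
      exact le_add_self
  set R : ℝ → ℝ := fun x => marchaud (1 - β) (reflect g) (1 - x) with hR
  set B := C * (1 + (1 - β) / (r - (1 - β))) with hB
  have hRm : AEStronglyMeasurable R (volume.restrict (Ioo (0 : ℝ) 1)) :=
    (aestronglyMeasurable_marchaud_reflect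
      (hg.reflect.continuous hr).measurable (1 - β)).mono_set Ioo_subset_Iio_self
  have hRb : ∀ᵐ x ∂volume.restrict (Ioo (0 : ℝ) 1), ‖R x‖ ≤ B := by
    filter_upwards [ae_restrict_mem measurableSet_Ioo] with x hx
    exact hg.reflect.abs_marchaud_le (by linarith) hβr (reflect_zero g)
      (by linarith [hx.2]) (by linarith [hx.1])
  have hMi := fun n => integrable_marchaud hβ0 hβ1 (hF n) (hFn n)
  have hs := hasSum_integral_of_summable_integral_norm (μ := volume.restrict (Ioo (0 : ℝ) 1))
    (F := fun n x => marchaud β (F n) x * R x) (fun n => (hMi n).mul_bdd hRm hRb) ?_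
  · have hconv : ∀ φ : ℝ → ℝ, ∫ x in (0 : ℝ)..1, φ x = ∫ x in Ioo (0 : ℝ) 1, φ x := fun φ => by
      rw [integral_Ioo_eq _ _ zero_le_one, integral_indicator measurableSet_Ioo]
    have hlim : ∫ x in Ioo (0 : ℝ) 1, ∑' n, marchaud β (F n) x * R x
        = ∫ x in (0 : ℝ)..1, marchaud β f x * R x := by
      rw [hconv]
      refine integral_congr_ae ?_
      filter_upwards [hM] with x hx
      exact (hx.mul_right (R x)).tsum_eq
    rw [hlim] at hs
    simp_rw [← hconv] at hs
    rw [funext hJ] at hs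
    set A := ∫ x in (0 : ℝ)..1, marchaud β f x * R x with hA
    have hΓ : Real.Gamma β * Real.Gamma (1 - β) ≠ 0 := (mul_pos hΓ1 hΓ2).ne'
    refine ⟨-(Real.Gamma β * Real.Gamma (1 - β))⁻¹ * A, ?_, ?_⟩
    · have hJ' : J = fun n => -(Real.Gamma β * Real.Gamma (1 - β))⁻¹
          * -(Real.Gamma β * Real.Gamma (1 - β) * J n) := by
        funext n
        field_simp
      rw [hJ']
      exact hs.mul_left _
    · refine hasIntegral_of_fracNorm hβ0 hβ1 hβr hf hfn hg ?_
      change A = _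
      field_simp
  · refine Summable.of_nonneg_of_le (fun n => integral_nonneg fun _ => norm_nonneg _)
      (fun n => ?_) ((ENNReal.summable_toReal hnorm).mul_right B)
    calc ∫ x in Ioo (0 : ℝ) 1, ‖marchaud β (F n) x * R x‖
        ≤ ∫ x in Ioo (0 : ℝ) 1, ‖marchaud β (F n) x‖ * B := by
          refine integral_mono_ae ((hMi n).mul_bdd hRm hRb).norm ((hMi n).norm.mul_const B) ?_
          filter_upwards [hRb] with x hx
          rw [norm_mul]
          gcongr
      _ = (∫ x in Ioo (0 : ℝ) 1, ‖marchaud β (F n) x‖) * B := integral_mul_const _ _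
      _ ≤ (fracNorm β 0 1 (F n)).toReal * B := by
          refine mul_le_mul_of_nonneg_right ?_ ?_
          · rw [integral_norm_eq_lintegral_enorm (hMi n).aestronglyMeasurable]
            refine ENNReal.toReal_mono (hFn n).ne ?_
            rw [fracNorm_eq, ← restrict_Ioo_eq_Icc]
            exact setLIntegral_mono' measurableSet_Ioo fun x hx =>
              enorm_marchaud_le hβ0 hβ1 _ hx.1
          · have : 0 < r - (1 - β) := by linarith
            have : 0 < 1 - β := by linarith
            have := hg.nonneg
            positivity

/-! ### Norm estimates -/

/-- Majorant, as a function of `t - s`, of the double integrand of `fracNorm` for functions whose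
increments are bounded by `L * min (t - s) Δ ^ r`. -/
def cutKernel (L Δ r β : ℝ) : ℝ → ℝ≥0∞ :=
  (Ioi (0 : ℝ)).indicator fun u => ENNReal.ofReal (L * min u Δ ^ r / u ^ (β + 1))

lemma measurable_cutKernel (L Δ r β : ℝ) : Measurable (cutKernel L Δ r β) :=
  Measurable.indicator (by fun_prop) measurableSet_Ioi

/-- Splitting at `Δ`, the integrand is `L * u ^ (r - β - 1)` below, integrable at `0` since `β < r`,
and `L * Δ ^ r * u ^ (-β - 1)` above, integrable at infinity since `β > 0`. -/
lemma lintegral_cutKernel_le {L Δ r β : ℝ} (hL : 0 ≤ L) (hΔ : 0 < Δ) (hβ0 : 0 < β) (hβr : β < r) :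
    ∫⁻ u, cutKernel L Δ r β u ≤ ENNReal.ofReal (L * Δ ^ (r - β) * (1 / (r - β) + 1 / β)) := by
  have hrβ : 0 < r - β := sub_pos.2 hβr
  have h1 : ∫⁻ u in Ioc 0 Δ, ENNReal.ofReal (L * min u Δ ^ r / u ^ (β + 1))
      ≤ ENNReal.ofReal (L * (Δ ^ (r - β) / (r - β))) := by
    have hi : IntegrableOn (fun u : ℝ => L * u ^ (r - β - 1)) (Ioc 0 Δ) := by
      rw [← intervalIntegrable_iff_integrableOn_Ioc_of_le hΔ.le]
      exact (intervalIntegral.intervalIntegrable_rpow' (by linarith)).const_mul L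
    have hv : ∫ u in Ioc 0 Δ, L * u ^ (r - β - 1) = L * (Δ ^ (r - β) / (r - β)) := by
      rw [← intervalIntegral.integral_of_le hΔ.le, intervalIntegral.integral_const_mul,
        integral_rpow (Or.inl (by linarith)), sub_add_cancel, Real.zero_rpow hrβ.ne', sub_zero]
    rw [← hv, ofReal_integral_eq_lintegral_ofReal hi]
    · refine setLIntegral_mono' measurableSet_Ioc fun u hu => ENNReal.ofReal_le_ofReal ?_
      rw [min_eq_left hu.2, mul_div_assoc, ← Real.rpow_sub hu.1]
      exact (congrArg (fun y => L * u ^ y) (by ring)).le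
    · filter_upwards [ae_restrict_mem measurableSet_Ioc] with u hu
      exact mul_nonneg hL (Real.rpow_nonneg hu.1.le _)
  have h2 : ∫⁻ u in Ioi Δ, ENNReal.ofReal (L * min u Δ ^ r / u ^ (β + 1))
      ≤ ENNReal.ofReal (L * (Δ ^ (r - β) / β)) := by
    have hi : IntegrableOn (fun u : ℝ => L * Δ ^ r * u ^ (-β - 1)) (Ioi Δ) :=
      (integrableOn_Ioi_rpow_of_lt (by linarith) hΔ).const_mul _
    have hv : ∫ u in Ioi Δ, L * Δ ^ r * u ^ (-β - 1) = L * (Δ ^ (r - β) / β) := by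
      rw [integral_const_mul, integral_Ioi_rpow_of_lt (by linarith) hΔ, sub_add_cancel,
        sub_eq_add_neg r β, Real.rpow_add hΔ]
      field_simp
    rw [← hv, ofReal_integral_eq_lintegral_ofReal hi]
    · refine setLIntegral_mono' measurableSet_Ioi fun u hu => ENNReal.ofReal_le_ofReal ?_
      have hu0 : 0 < u := hΔ.trans hu
      rw [min_eq_right (le_of_lt hu), div_eq_mul_inv, ← Real.rpow_neg hu0.le]
      exact (congrArg (fun y => L * Δ ^ r * u ^ y) (by ring)).le
    · filter_upwards [ae_restrict_mem measurableSet_Ioi] with u hu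
      exact mul_nonneg (mul_nonneg hL (Real.rpow_nonneg hΔ.le _))
        (Real.rpow_nonneg (hΔ.trans hu).le _)
  rw [cutKernel, lintegral_indicator measurableSet_Ioi, ← Ioc_union_Ioi_eq_Ioi hΔ.le,
    lintegral_union measurableSet_Ioi (Ioc_disjoint_Ioi le_rfl)]
  refine (add_le_add h1 h2).trans ?_
  rw [← ENNReal.ofReal_add (by positivity) (by positivity)]
  exact ENNReal.ofReal_le_ofReal (le_of_eq (by ring))

lemma ofReal_kernel_le_cutKernel {L Δ r β s t : ℝ} {f : ℝ → ℝ} (hst : s ≤ t)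
    (h : |f t - f s| ≤ L * min (t - s) Δ ^ r) :
    ENNReal.ofReal (|f t - f s| / (t - s) ^ (β + 1)) ≤ cutKernel L Δ r β (t - s) := by
  rcases hst.eq_or_lt with rfl | hst
  · simp
  · rw [cutKernel, indicator_of_mem (mem_Ioi.2 (sub_pos.2 hst))]
    exact ENNReal.ofReal_le_ofReal (div_le_div_of_nonneg_right h
      (Real.rpow_nonneg (sub_pos.2 hst).le _))

/-- Needed for the finitely many early blocks, which may miss their level and then stay nonzero up
to time `1`. -/
lemma IsHolder.fracNorm_lt_top {L r β : ℝ} {f : ℝ → ℝ} (hf : IsHolder L r f) (h0 : f 0 = 0)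
    (hβ0 : 0 < β) (hβr : β < r) : fracNorm β 0 1 f < ∞ := by
  have hL := hf.nonneg
  set B := ENNReal.ofReal L
    + ENNReal.ofReal (L * (1 : ℝ) ^ (r - β) * (1 / (r - β) + 1 / β)) with hB
  have hle : ∀ t ∈ Icc (0 : ℝ) 1, fracDensity β f t ≤ B := fun t ht => by
    refine add_le_add (ENNReal.ofReal_le_ofReal ?_) ?_
    · rcases ht.1.eq_or_lt with rfl | ht0
      · simpa [h0] using hL
      · have h1 : |f t| ≤ L * t ^ r := by simpa [h0, abs_of_pos ht0] using hf 0 t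
        have h2 : t ^ (r - β) ≤ 1 := Real.rpow_le_one ht.1 ht.2 (by linarith)
        calc |f t| / t ^ β ≤ L * t ^ r / t ^ β := by gcongr
          _ = L * t ^ (r - β) := by rw [mul_div_assoc, Real.rpow_sub ht0]
          _ ≤ L := mul_le_of_le_one_right hL h2
    · refine le_trans ?_ (lintegral_cutKernel_le hL one_pos hβ0 hβr)
      rw [← lintegral_sub_left_eq_self (cutKernel L 1 r β) t]
      refine le_trans (setLIntegral_mono' measurableSet_Icc fun s hs => ?_)
        (setLIntegral_le_lintegral (Icc 0 t) _)
      refine ofReal_kernel_le_cutKernel hs.2 ?_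
      rw [min_eq_left (by linarith [hs.1, ht.2])]
      simpa [abs_of_nonneg (sub_nonneg.2 hs.2)] using hf s t
  rw [fracNorm_eq]
  refine lt_of_le_of_lt (setLIntegral_mono' measurableSet_Icc hle) ?_
  rw [setLIntegral_const, Real.volume_Icc]
  exact ENNReal.mul_lt_top (by simp [hB]) ENNReal.ofReal_lt_top

/-- The norm of a Hölder function supported in a short interval. -/
lemma IsHolder.fracNorm_le_of_support {L r β c d : ℝ} {f : ℝ → ℝ} (hf : IsHolder L r f)
    (hβ0 : 0 < β) (hβ1 : β < 1) (hβr : β < r) (hc : 1 / 2 ≤ c) (hcd : c < d) (hd : d ≤ 1)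
    (hfc : ∀ s ≤ c, f s = 0) (hfd : ∀ s, d ≤ s → f s = 0) :
    fracNorm β 0 1 f
      ≤ ENNReal.ofReal ((2 + 2 * (1 / (r - β) + 1 / β)) * L * (d - c) ^ (1 + r - β)) := by
  have hL := hf.nonneg
  have hr : 0 < r := hβ0.trans hβr
  have hrβ : 0 < r - β := sub_pos.2 hβr
  set Δ := d - c with hΔdef
  have hΔ : 0 < Δ := sub_pos.2 hcd
  -- Factoring through `clamp` caps the increments at the length `Δ` of the support, as `cutKernel`
  -- requires.
  have hclamp : ∀ s, f s = f (clamp c d s) := fun s => by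
    rcases le_total s c with h | h
    · rw [clamp_of_le h hcd.le, hfc s h, hfc c le_rfl]
    · rcases le_total s d with h' | h'
      · rw [clamp_of_mem h h']
      · rw [clamp_of_ge h' hcd.le, hfd s h', hfd d le_rfl]
  have hclampΔ : ∀ s t, |clamp c d t - clamp c d s| ≤ Δ := fun s t => by
    have h1 : ∀ u, c ≤ clamp c d u := fun u => le_max_left _ _
    have h2 : ∀ u, clamp c d u ≤ d := fun u => max_le hcd.le (min_le_left _ _)
    rw [abs_le]
    constructor <;> linarith [h1 s, h1 t, h2 s, h2 t]
  have hinc : ∀ s t, s ≤ t → |f t - f s| ≤ L * min (t - s) Δ ^ r := fun s t hst => by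
    rw [hclamp t, hclamp s]
    refine (hf _ _).trans (mul_le_mul_of_nonneg_left
      (Real.rpow_le_rpow (abs_nonneg _) (le_min ?_ (hclampΔ s t)) hr.le) hL)
    exact (abs_clamp_sub_le c d s t).trans_eq (abs_of_nonneg (sub_nonneg.2 hst))
  have hsup : ∀ t, |f t| ≤ L * Δ ^ r := fun t => by
    have h := hf (clamp c d c) (clamp c d t)
    rw [← hclamp, ← hclamp, hfc c le_rfl, sub_zero] at h
    exact h.trans (mul_le_mul_of_nonneg_left
      (Real.rpow_le_rpow (abs_nonneg _) (hclampΔ c t) hr.le) hL)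
  set k := cutKernel L Δ r β with hk
  have hkm : Measurable k := measurable_cutKernel _ _ _ _
  set e : ℝ → ℝ≥0∞ := (Icc c d).indicator 1 with he
  have hem : Measurable e := measurable_one.indicator measurableSet_Icc
  have hzero : ∀ t ∉ Icc c d, f t = 0 := fun t ht => by
    rcases lt_or_ge t c with h | h
    · exact hfc t h.le
    · exact hfd t (le_of_not_ge fun h' => ht ⟨h, h'⟩)
  have hvole : ∫⁻ t, e t = ENNReal.ofReal Δ := by
    rw [he, lintegral_indicator measurableSet_Icc]
    simp [hΔdef]
  -- An increment vanishes unless `t` or `s` lies in `[c, d]`. Each case contributes at most `Δ`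
  -- times the integral of `k`.
  have hdens : ∀ t ∈ Icc (0 : ℝ) 1, fracDensity β f t
      ≤ e t * ENNReal.ofReal (2 * (L * Δ ^ r)) + (e t * (∫⁻ s, k (t - s))
        + ∫⁻ s, e s * k (t - s)) := fun t ht => by
    refine add_le_add ?_ ?_
    · by_cases htc : t ∈ Icc c d
      · rw [he, indicator_of_mem htc, Pi.one_apply, one_mul]
        refine ENNReal.ofReal_le_ofReal ?_
        have ht2 : (1 : ℝ) / 2 ≤ t := hc.trans htc.1
        -- The support stays away from `0`, so the weight `t ^ (-β)` costs at most a factor `2`.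
        have hb : (1 : ℝ) / 2 ≤ t ^ β :=
          calc (1 : ℝ) / 2 = (1 / 2) ^ (1 : ℝ) := (Real.rpow_one _).symm
            _ ≤ (1 / 2) ^ β :=
              Real.rpow_le_rpow_of_exponent_ge (by norm_num) (by norm_num) hβ1.le
            _ ≤ t ^ β := Real.rpow_le_rpow (by norm_num) ht2 hβ0.le
        rw [div_le_iff₀ (by linarith)]
        nlinarith [hsup t, abs_nonneg (f t)]
      · rw [hzero t htc]
        simp
    · have hkt : Measurable fun s => k (t - s) := by fun_prop
      rw [← lintegral_const_mul _ hkt, ← lintegral_add_left (hkt.const_mul _)]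
      refine le_trans (setLIntegral_mono' measurableSet_Icc fun s hs => ?_)
        (setLIntegral_le_lintegral (Icc 0 t) _)
      have hks := ofReal_kernel_le_cutKernel (β := β) hs.2 (hinc s t hs.2)
      by_cases htc : t ∈ Icc c d
      · refine le_trans ?_ le_self_add
        rw [he, indicator_of_mem htc, Pi.one_apply, one_mul]
        exact hks
      · by_cases hsc : s ∈ Icc c d
        · refine le_trans ?_ le_add_self
          rw [he, indicator_of_mem hsc, Pi.one_apply, one_mul]
          exact hks
        · rw [hzero t htc, hzero s hsc]
          simp
  have hkint : ∀ t, ∫⁻ s, k (t - s) = ∫⁻ u, k u := fun t => lintegral_sub_left_eq_self k t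
  have hswap : ∫⁻ t, ∫⁻ s, e s * k (t - s) = ENNReal.ofReal Δ * ∫⁻ u, k u := by
    rw [lintegral_lintegral_swap (Measurable.aemeasurable (by fun_prop))]
    have hs : ∀ s, ∫⁻ t, e s * k (t - s) = e s * ∫⁻ u, k u := fun s => by
      rw [lintegral_const_mul _ (by fun_prop), lintegral_sub_right_eq_self k]
    simp_rw [hs]
    rw [lintegral_mul_const _ hem, hvole]
  have hkle := lintegral_cutKernel_le hL hΔ hβ0 hβr
  have hΔ1 : Δ ≤ 1 := by linarith
  calc fracNorm β 0 1 f = ∫⁻ t in Icc 0 1, fracDensity β f t := fracNorm_eq β f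
    _ ≤ ∫⁻ t in Icc 0 1, (e t * ENNReal.ofReal (2 * (L * Δ ^ r)) + (e t * (∫⁻ s, k (t - s))
        + ∫⁻ s, e s * k (t - s))) := setLIntegral_mono' measurableSet_Icc hdens
    _ ≤ ∫⁻ t, (e t * ENNReal.ofReal (2 * (L * Δ ^ r)) + (e t * (∫⁻ s, k (t - s))
        + ∫⁻ s, e s * k (t - s))) := setLIntegral_le_lintegral _ _
    _ = ENNReal.ofReal Δ * ENNReal.ofReal (2 * (L * Δ ^ r)) + (ENNReal.ofReal Δ * (∫⁻ u, k u)
        + ENNReal.ofReal Δ * ∫⁻ u, k u) := by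
      simp_rw [hkint]
      rw [lintegral_add_left (hem.mul_const _), lintegral_add_left (hem.mul_const _),
        lintegral_mul_const _ hem, lintegral_mul_const _ hem, hvole, hswap]
    _ ≤ ENNReal.ofReal Δ * ENNReal.ofReal (2 * (L * Δ ^ r))
        + (ENNReal.ofReal Δ * ENNReal.ofReal (L * Δ ^ (r - β) * (1 / (r - β) + 1 / β))
        + ENNReal.ofReal Δ * ENNReal.ofReal (L * Δ ^ (r - β) * (1 / (r - β) + 1 / β))) := by
      gcongr
    _ = ENNReal.ofReal (Δ * (2 * (L * Δ ^ r))
        + (Δ * (L * Δ ^ (r - β) * (1 / (r - β) + 1 / β))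
          + Δ * (L * Δ ^ (r - β) * (1 / (r - β) + 1 / β)))) := by
      rw [← ENNReal.ofReal_mul hΔ.le, ← ENNReal.ofReal_mul hΔ.le,
        ← ENNReal.ofReal_add (by positivity) (by positivity),
        ← ENNReal.ofReal_add (by positivity) (by positivity)]
    _ ≤ ENNReal.ofReal ((2 + 2 * (1 / (r - β) + 1 / β)) * L * Δ ^ (1 + r - β)) := by
      refine ENNReal.ofReal_le_ofReal ?_
      have h1 : Δ ^ (1 + r - β) = Δ * Δ ^ (r - β) := by
        rw [add_sub_assoc, Real.rpow_add hΔ, Real.rpow_one]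
      have h2 : Δ ^ r ≤ Δ ^ (r - β) :=
        Real.rpow_le_rpow_of_exponent_ge hΔ hΔ1 (by linarith)
      rw [h1]
      have h3 : Δ * (2 * (L * Δ ^ r)) ≤ Δ * (2 * (L * Δ ^ (r - β))) := by gcongr
      linarith

/-! ### Profiles and elementary blocks -/

/-- A smooth even function that grows from `0` at the origin to `1` outside `(-1, 1)`. -/
def hump (x : ℝ) : ℝ := Real.smoothTransition (x ^ 2)

lemma contDiff_hump : ContDiff ℝ 2 hump :=
  (Real.smoothTransition.contDiff (n := 2)).comp (contDiff_id.pow 2)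

lemma hump_of_one_le {x : ℝ} (hx : 1 ≤ |x|) : hump x = 1 :=
  Real.smoothTransition.one_of_one_le ((one_le_sq_iff_one_le_abs x).2 hx)

lemma hump_zero : hump 0 = 0 := by simp [hump]

lemma contDiff_deriv_hump : ContDiff ℝ 1 (deriv hump) := by
  have h : ContDiff ℝ (1 + 1) hump := by
    rw [one_add_one_eq_two]
    exact contDiff_hump
  exact (contDiff_succ_iff_deriv.1 h).2.2

/-- Such `x` are maximum points, including `|x| = 1`. Hence a block is already zero when it reaches
its level, and stopping it there causes no jump. -/
lemma deriv_hump_of_one_le {x : ℝ} (hx : 1 ≤ |x|) : deriv hump x = 0 := by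
  refine IsLocalMax.deriv_eq_zero (Eventually.of_forall fun y => ?_)
  rw [hump_of_one_le hx]
  exact Real.smoothTransition.le_one _

lemma deriv_hump_zero : deriv hump 0 = 0 := by
  refine IsLocalMin.deriv_eq_zero (Eventually.of_forall fun y => ?_)
  rw [hump_zero]
  exact Real.smoothTransition.nonneg _

lemma exists_bound_deriv_deriv_hump : ∃ M, ∀ x, |deriv (deriv hump) x| ≤ M := by
  have hs : HasCompactSupport (deriv hump) :=
    HasCompactSupport.intro (isCompact_Icc (a := (-1 : ℝ)) (b := 1)) fun x hx =>
      deriv_hump_of_one_le (by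
        by_contra h
        exact hx (abs_le.1 (not_le.1 h).le))
  exact (contDiff_deriv_hump.continuous_deriv le_rfl).bounded_above_of_compact_support hs.deriv

/-- The profile of the integral of a block: it reaches the value `1` at the level `ε`. -/
def profile (ε x : ℝ) : ℝ := hump (x / ε)

/-- The derivative of `profile ε`; it vanishes at the origin and beyond the level `ε`. -/
def bump (ε x : ℝ) : ℝ := ε⁻¹ * deriv hump (x / ε)

/-- The derivative of `bump ε`. -/
def bumpDeriv (ε x : ℝ) : ℝ := ε⁻¹ * (ε⁻¹ * deriv (deriv hump) (x / ε))

lemma hasDerivAt_profile (ε x : ℝ) : HasDerivAt (profile ε) (bump ε x) x := by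
  have h1 : HasDerivAt hump (deriv hump (x / ε)) (x / ε) :=
    (contDiff_hump.differentiable two_ne_zero _).hasDerivAt
  exact (h1.comp x ((hasDerivAt_id x).div_const ε)).congr_deriv (by rw [bump]; ring)

lemma hasDerivAt_bump (ε x : ℝ) : HasDerivAt (bump ε) (bumpDeriv ε x) x := by
  have h1 : HasDerivAt (deriv hump) (deriv (deriv hump) (x / ε)) (x / ε) :=
    (contDiff_deriv_hump.differentiable one_ne_zero _).hasDerivAt
  refine ((h1.comp x ((hasDerivAt_id x).div_const ε)).const_mul ε⁻¹).congr_deriv ?_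
  rw [bumpDeriv]
  ring

lemma continuous_bump (ε : ℝ) : Continuous (bump ε) :=
  continuous_iff_continuousAt.2 fun x => (hasDerivAt_bump ε x).continuousAt

lemma continuous_profile (ε : ℝ) : Continuous (profile ε) :=
  continuous_iff_continuousAt.2 fun x => (hasDerivAt_profile ε x).continuousAt

lemma continuous_bumpDeriv (ε : ℝ) : Continuous (bumpDeriv ε) := by
  have := contDiff_deriv_hump.continuous_deriv le_rfl
  unfold bumpDeriv
  fun_prop

lemma bump_zero (ε : ℝ) : bump ε 0 = 0 := by simp [bump, deriv_hump_zero]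

lemma profile_zero (ε : ℝ) : profile ε 0 = 0 := by simp [profile, hump_zero]

lemma one_le_abs_div {ε x : ℝ} (hε : 0 < ε) (hx : ε ≤ |x|) : 1 ≤ |x / ε| := by
  rwa [abs_div, abs_of_pos hε, one_le_div hε]

lemma bump_of_le {ε x : ℝ} (hε : 0 < ε) (hx : ε ≤ |x|) : bump ε x = 0 := by
  rw [bump, deriv_hump_of_one_le (one_le_abs_div hε hx), mul_zero]

lemma profile_of_le {ε x : ℝ} (hε : 0 < ε) (hx : ε ≤ |x|) : profile ε x = 1 :=
  hump_of_one_le (one_le_abs_div hε hx)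

lemma abs_bumpDeriv_le {M ε : ℝ} (hM : ∀ x, |deriv (deriv hump) x| ≤ M) (hε : 0 < ε) (x : ℝ) :
    |bumpDeriv ε x| ≤ M / ε ^ 2 := by
  rw [bumpDeriv, abs_mul, abs_mul, abs_of_pos (inv_pos.2 hε)]
  calc ε⁻¹ * (ε⁻¹ * |deriv (deriv hump) (x / ε)|) ≤ ε⁻¹ * (ε⁻¹ * M) := by gcongr; exact hM _
    _ = M / ε ^ 2 := by field_simp

/-- No time of a fixed dense sequence in `[c, t]` sees the path `x` at a distance `≥ ε` from
`x c`. -/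
def Unhit (x : I → ℝ) (ε : ℝ) (c t : I) : Prop :=
  ∀ k, c ≤ TopologicalSpace.denseSeq I k → TopologicalSpace.denseSeq I k ≤ t →
    |x (TopologicalSpace.denseSeq I k) - x c| < ε

open Classical in
/-- The elementary integrand on `[c, d]`: it follows `bump ε (x - x c)` until the path has moved
by `ε`, then it vanishes. If this does not happen before `d`, it is frozen from `d` on. -/
def block (x : I → ℝ) (ε : ℝ) (c d t : I) : ℝ :=
  if c ≤ t ∧ Unhit x ε c (min t d) then bump ε (x (min t d) - x c) else 0

open Classical in
/-- The integral of `block x ε c d` over `[0, d]`. -/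
def blockValue (x : I → ℝ) (ε : ℝ) (c d : I) : ℝ :=
  if Unhit x ε c d then profile ε (x d - x c) else 1

/-- A path on `[0, 1]` extended to the real line by its end values. -/
abbrev ext01 (x : I → ℝ) : ℝ → ℝ := IccExtend zero_le_one x

lemma ext01_coe (x : I → ℝ) (t : I) : ext01 x t = x t := IccExtend_val _ _ _

lemma isHolder_ext01 {x : I → ℝ} {C r : ℝ} (hr : 0 ≤ r)
    (h : ∀ s t : I, |x t - x s| ≤ C * |(t : ℝ) - s| ^ r) : IsHolder C r (ext01 x) := by
  have hC : 0 ≤ C := by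
    have := (abs_nonneg _).trans (h 0 1)
    simpa using this
  intro s t
  refine (h _ _).trans (mul_le_mul_of_nonneg_left (Real.rpow_le_rpow (abs_nonneg _) ?_ hr) hC)
  have := abs_clamp_sub_le 0 1 s t
  simpa only [coe_projIcc, clamp] using this

/-! ### Hitting times -/

/-- The hitting time that stops a block. -/
def hitTime (x : I → ℝ) (ε : ℝ) (c d : I) : ℝ :=
  sInf (insert (d : ℝ) {q : ℝ | ∃ k, (TopologicalSpace.denseSeq I k : ℝ) = q ∧
    c ≤ TopologicalSpace.denseSeq I k ∧ TopologicalSpace.denseSeq I k ≤ d ∧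
      ε ≤ |x (TopologicalSpace.denseSeq I k) - x c|})

section Hit

variable {x : I → ℝ} {ε : ℝ} {c d t : I}

lemma le_hitTime {u : I} (hu : u ≤ d) (h : Unhit x ε c u) :
    (u : ℝ) ≤ hitTime x ε c d := by
  refine le_csInf (insert_nonempty _ _) ?_
  rintro q (rfl | ⟨k, rfl, h1, h2, h3⟩)
  · exact hu
  · by_contra hlt
    exact absurd (h k h1 (le_of_lt (not_le.1 hlt))) (not_lt.2 h3)

lemma bddBelow_hits (x : I → ℝ) (ε : ℝ) (c d : I) :
    BddBelow (insert (d : ℝ) {q : ℝ | ∃ k, (TopologicalSpace.denseSeq I k : ℝ) = q ∧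
    c ≤ TopologicalSpace.denseSeq I k ∧ TopologicalSpace.denseSeq I k ≤ d ∧
      ε ≤ |x (TopologicalSpace.denseSeq I k) - x c|}) := by
  refine ⟨0, ?_⟩
  rintro q (rfl | ⟨k, rfl, -⟩)
  · exact d.2.1
  · exact (TopologicalSpace.denseSeq I k).2.1

lemma hitTime_le_right : hitTime x ε c d ≤ d :=
  csInf_le (bddBelow_hits x ε c d) (mem_insert _ _)

lemma le_hitTime_left (hcd : c ≤ d) : (c : ℝ) ≤ hitTime x ε c d := by
  refine le_csInf (insert_nonempty _ _) ?_
  rintro q (rfl | ⟨k, rfl, h1, -⟩)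
  · exact hcd
  · exact h1

lemma hitTime_of_unhit (h : Unhit x ε c d) : hitTime x ε c d = d :=
  le_antisymm hitTime_le_right (le_hitTime le_rfl h)

/-- The infimum lies in the closure of the hits, and reaching the level is a closed condition. The
inserted point `d` does no harm: if the infimum equals `d`, the given hit sits at `d` itself. -/
lemma hitTime_of_not_unhit (hx : Continuous (ext01 x)) {u : I} (hu : u ≤ d)
    (h : ¬Unhit x ε c u) :
    hitTime x ε c d ≤ u ∧ ε ≤ |ext01 x (hitTime x ε c d) - ext01 x c| := by
  simp only [Unhit, not_forall, not_lt, exists_prop] at h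
  obtain ⟨k, h1, h2, h3⟩ := h
  have hle : hitTime x ε c d ≤ TopologicalSpace.denseSeq I k :=
    csInf_le (bddBelow_hits x ε c d) (mem_insert_of_mem _ ⟨k, rfl, h1, h2.trans hu, h3⟩)
  refine ⟨hle.trans h2, ?_⟩
  have hset : IsClosed {q : ℝ | ε ≤ |ext01 x q - ext01 x c|} :=
    isClosed_le continuous_const (by fun_prop)
  have hmem := csInf_mem_closure (insert_nonempty _ _) (bddBelow_hits x ε c d)
  change hitTime x ε c d ∈ _ at hmem
  rw [insert_eq, closure_union, closure_singleton] at hmem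
  rcases hmem with hmem | hmem
  · have hd : (d : ℝ) = TopologicalSpace.denseSeq I k := by
      rw [mem_singleton_iff] at hmem
      exact le_antisymm (hmem ▸ hle) (h2.trans hu)
    rw [mem_singleton_iff.1 hmem, hd, ext01_coe, ext01_coe]
    exact h3
  · refine hset.closure_subset_iff.2 ?_ hmem
    rintro q ⟨j, rfl, -, -, h4⟩
    simpa only [mem_ofPred_eq, ext01_coe] using h4

/-- `block` uses only the past of `t`, as adaptedness demands; `frozen` suits the chain rule. They
agree after a hit because `bump ε` vanishes at the level, so the frozen value is `0`. -/
lemma block_eq_frozen (hx : Continuous (ext01 x)) (hε : 0 < ε) (hcd : c ≤ d) :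
    block x ε c d t = frozen (bump ε) (ext01 x) c (hitTime x ε c d) t := by
  have hcσ : (c : ℝ) ≤ hitTime x ε c d := le_hitTime_left hcd
  rw [block]
  split_ifs with h
  · have hu : ((min t d : I) : ℝ) ≤ hitTime x ε c d :=
      le_hitTime (min_le_right _ _) h.2
    have hcl : clamp c (hitTime x ε c d) t = (min t d : I) := by
      rcases le_total t d with htd | htd
      · rw [min_eq_left htd] at hu ⊢
        exact clamp_of_mem h.1 hu
      · rw [min_eq_right htd] at hu ⊢
        have : hitTime x ε c d = d := le_antisymm hitTime_le_right hu
        rw [this]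
        exact clamp_of_ge htd hcd
    rw [frozen, hcl, ext01_coe, ext01_coe]
  · by_cases hct : c ≤ t
    · have h' : ¬Unhit x ε c (min t d) := fun hh => h ⟨hct, hh⟩
      obtain ⟨h1, h2⟩ := hitTime_of_not_unhit (d := d) hx (min_le_right t d) h'
      have h3 : ((min t d : I) : ℝ) ≤ t := min_le_left t d
      rw [frozen, clamp_of_ge (h1.trans h3) hcσ, bump_of_le hε h2]
    · rw [frozen_of_le hcσ (bump_zero ε) (le_of_not_ge hct)]

/-- This turns the chain-rule value at the hitting time into the bookkeeping at `d`: a hit gives `1`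
and no position, a miss gives the profile and a position held from `d` on. -/
lemma block_right (hcd : c ≤ d) (hε : 0 < ε) (hx : Continuous (ext01 x)) :
    profile ε (ext01 x (hitTime x ε c d) - ext01 x c)
      + bump ε (ext01 x (hitTime x ε c d) - ext01 x c) * (ext01 x 1 - ext01 x (hitTime x ε c d))
      = blockValue x ε c d + block x ε c d d * (x 1 - x d) := by
  have h1 : ext01 x 1 = x 1 := ext01_coe x 1
  rw [block, blockValue, min_self]
  by_cases h : Unhit x ε c d
  · rw [hitTime_of_unhit h, if_pos h, if_pos ⟨hcd, h⟩, ext01_coe, ext01_coe, h1]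
  · have h2 := (hitTime_of_not_unhit hx le_rfl h).2
    rw [if_neg h, if_neg fun hh => h hh.2, bump_of_le hε h2, profile_of_le hε h2]
    ring

/-- A strict excess persists on an open set of times, which meets `(c, d)` and hence the dense
sequence there. The strict inequality is the complement of the small ball event. -/
lemma not_unhit_of_exists (hx : Continuous x) (hcd : c < d)
    (h : ∃ u ∈ Icc c d, ε < |x u - x c|) : ¬Unhit x ε c d := by
  obtain ⟨u, hu, hux⟩ := h
  have hopen : IsOpen {v : I | ε < |x v - x c|} := isOpen_lt continuous_const (by fun_prop)
  rw [← closure_Ioo hcd.ne, mem_closure_iff] at hu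
  obtain ⟨v, hv⟩ := hu _ hopen hux
  obtain ⟨k, hk, hk1, hk2⟩ := (TopologicalSpace.denseRange_denseSeq I).exists_mem_open
    (hopen.inter isOpen_Ioo) ⟨v, hv⟩
  exact fun h => lt_asymm hk (h k hk1.le hk2.le)

end Hit

/-! ### The dyadic grid and the pathwise representation -/

/-- The grid of times `1 - 2 ^ (-(n + 1))`. -/
def gridTime (n : ℕ) : I :=
  ⟨1 - (1 / 2) ^ (n + 1), sub_nonneg.2 (pow_le_one₀ (by norm_num) (by norm_num)),
    sub_le_self _ (by positivity)⟩

/-- The mesh `gridTime (n + 1) - gridTime n`. -/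
def gridStep (n : ℕ) : ℝ := (1 / 2) ^ (n + 2)

lemma coe_gridTime (n : ℕ) : (gridTime n : ℝ) = 1 - (1 / 2) ^ (n + 1) := rfl

lemma gridStep_pos (n : ℕ) : 0 < gridStep n := by unfold gridStep; positivity

lemma gridStep_lt_one (n : ℕ) : gridStep n < 1 :=
  pow_lt_one₀ (by norm_num) (by norm_num) (by positivity)

lemma gridStep_succ (n : ℕ) : gridStep n = 2 * gridStep (n + 1) := by
  unfold gridStep; ring

lemma gridTime_succ_sub (n : ℕ) : (gridTime (n + 1) : ℝ) - gridTime n = gridStep n := by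
  rw [coe_gridTime, coe_gridTime, gridStep]; ring

lemma gridTime_strictMono : StrictMono gridTime :=
  strictMono_nat_of_lt_succ fun n => by
    have h : (gridTime n : ℝ) < gridTime (n + 1) := by
      linarith [gridTime_succ_sub n, gridStep_pos n]
    exact h

lemma half_le_gridTime (n : ℕ) : 1 / 2 ≤ (gridTime n : ℝ) := by
  have h : gridTime 0 ≤ gridTime n := gridTime_strictMono.monotone (Nat.zero_le n)
  have h' : (gridTime 0 : ℝ) ≤ gridTime n := h
  rw [coe_gridTime] at h'
  norm_num at h' ⊢
  exact h'

lemma tendsto_coe_gridTime : Tendsto (fun n => (gridTime n : ℝ)) atTop (𝓝 1) := by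
  have h : Tendsto (fun n : ℕ => (1 / 2 : ℝ) ^ (n + 1)) atTop (𝓝 0) :=
    (tendsto_pow_atTop_nhds_zero_of_lt_one (by norm_num) (by norm_num)).comp
      (tendsto_add_atTop_nat 1)
  simpa [coe_gridTime] using h.const_sub 1

lemma exists_lt_gridTime {t : I} (ht : t < 1) : ∃ N, t < gridTime N := by
  have h : ∀ᶠ n in atTop, (t : ℝ) < gridTime n :=
    tendsto_coe_gridTime.eventually (lt_mem_nhds ht)
  obtain ⟨N, hN⟩ := h.exists
  exact ⟨N, hN⟩

lemma gridStep_rpow (θ : ℝ) (n : ℕ) :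
    gridStep n ^ θ = ((1 / 2 : ℝ) ^ θ) ^ n * ((1 / 2 : ℝ) ^ θ) ^ 2 := by
  rw [gridStep, ← Real.rpow_natCast, ← Real.rpow_mul (by norm_num), mul_comm,
    Real.rpow_mul (by norm_num), Real.rpow_natCast, pow_add]

lemma summable_gridStep_rpow {θ : ℝ} (hθ : 0 < θ) : Summable fun n => gridStep n ^ θ := by
  simp_rw [gridStep_rpow]
  exact (summable_geometric_of_lt_one (by positivity)
    (Real.rpow_lt_one (by norm_num) (by norm_num) hθ)).mul_right _

section Path

variable (ρ : ℝ) (x z : I → ℝ)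

/-- The level that a path has to reach in the `n`-th block. -/
def level (n : ℕ) : ℝ := gridStep n ^ ρ

lemma level_pos (n : ℕ) : 0 < level ρ n := Real.rpow_pos_of_pos (gridStep_pos n) ρ

/-- The `n`-th block. -/
def gridBlock (n : ℕ) (t : I) : ℝ := block x (level ρ n) (gridTime n) (gridTime (n + 1)) t

/-- The capital accumulated by the first `n` blocks, written as `p.1 + p.2 * x t` at each time
`t ≥ gridTime n`. -/
def capital : ℕ → ℝ × ℝ
  | 0 => 0
  | n + 1 =>
    let p := capital n
    let gap := z (gridTime n) - p.1 - p.2 * x (gridTime n)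
    let y := gridBlock ρ x n (gridTime (n + 1))
    -- At time `t` the finished block is worth `gap * (blockValue + y * (x t - x (gridTime (n +
    -- 1))))`; its part without `x t` goes to `p.1`, the coefficient of `x t` to `p.2`.
    (p.1 + gap * (blockValue x (level ρ n) (gridTime n) (gridTime (n + 1))
        - y * x (gridTime (n + 1))), p.2 + gap * y)

/-- The amount that the `n`-th block has to gain. -/
def gap (n : ℕ) : ℝ :=
  z (gridTime n) - (capital ρ x z n).1 - (capital ρ x z n).2 * x (gridTime n)

/-- The integrand of the representation, for given paths `x` of the integrator and `z`. -/
def integrand (t : I) : ℝ := ∑' n, gap ρ x z n * gridBlock ρ x n t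

/-- The integral over `[0, 1]` of the `n`-th summand of `integrand`. -/
def gain (n : ℕ) : ℝ :=
  gap ρ x z n * (blockValue x (level ρ n) (gridTime n) (gridTime (n + 1))
    + gridBlock ρ x n (gridTime (n + 1)) * (x 1 - x (gridTime (n + 1))))

lemma sum_gain (n : ℕ) : ∑ k ∈ Finset.range n, gain ρ x z k
    = (capital ρ x z n).1 + (capital ρ x z n).2 * x 1 := by
  induction n with
  | zero => simp [capital]
  | succ n ih =>
    rw [Finset.sum_range_succ, ih]
    simp only [capital, gain, gap]
    ring

variable {ρ x z}

lemma gridBlock_of_le {n : ℕ} {t : I} (ht : t ≤ gridTime n) : gridBlock ρ x n t = 0 := by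
  rw [gridBlock, block]
  split_ifs with h
  · have h1 : t = gridTime n := le_antisymm ht h.1
    rw [h1, min_eq_left (gridTime_strictMono.monotone n.le_succ), sub_self, bump_zero]
  · rfl

lemma hasSum_integrand {t : I} (ht : t < 1) :
    HasSum (fun n => gap ρ x z n * gridBlock ρ x n t) (integrand ρ x z t) := by
  obtain ⟨N, hN⟩ := exists_lt_gridTime ht
  refine (summable_of_ne_finset_zero (s := Finset.range N) fun n hn => ?_).hasSum
  rw [gridBlock_of_le, mul_zero]
  exact hN.le.trans (gridTime_strictMono.monotone (not_lt.1 fun h => hn (Finset.mem_range.2 h)))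

lemma gridBlock_eq_frozen (hx : Continuous (ext01 x)) (n : ℕ) (t : I) :
    gridBlock ρ x n t = frozen (bump (level ρ n)) (ext01 x) (gridTime n)
      (hitTime x (level ρ n) (gridTime n) (gridTime (n + 1))) t :=
  block_eq_frozen hx (level_pos ρ n) (gridTime_strictMono.monotone n.le_succ)

lemma continuous_gridBlock (hx : Continuous (ext01 x)) (n : ℕ) :
    Continuous (gridBlock ρ x n) := by
  rw [funext (gridBlock_eq_frozen hx n)]
  have h1 := continuous_bump (level ρ n)
  have h2 := continuous_clamp (gridTime n)
    (hitTime x (level ρ n) (gridTime n) (gridTime (n + 1)))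
  unfold frozen
  fun_prop

lemma continuousOn_integrand (hx : Continuous (ext01 x)) :
    ContinuousOn (integrand ρ x z) (Iio 1) := by
  intro t ht
  refine ContinuousAt.continuousWithinAt ?_
  obtain ⟨N, hN⟩ := exists_lt_gridTime ht
  have heq : integrand ρ x z
      =ᶠ[𝓝 t] fun t => ∑ n ∈ Finset.range N, gap ρ x z n * gridBlock ρ x n t := by
    filter_upwards [Iio_mem_nhds hN] with s hs
    refine tsum_eq_sum fun n hn => ?_
    rw [gridBlock_of_le, mul_zero]
    exact (le_of_lt hs).trans
      (gridTime_strictMono.monotone (not_lt.1 fun h => hn (Finset.mem_range.2 h)))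
  refine ContinuousAt.congr (Continuous.continuousAt ?_) heq.symm
  have := fun n => continuous_gridBlock (ρ := ρ) hx n
  fun_prop

variable {N : ℕ}

/-- A block that reaches its level ends at zero and adds no position. -/
lemma capital_snd_eq (hhit : ∀ n ≥ N, ¬Unhit x (level ρ n) (gridTime n) (gridTime (n + 1)))
    {n : ℕ} (hn : N ≤ n) : (capital ρ x z n).2 = (capital ρ x z N).2 := by
  induction n, hn using Nat.le_induction with
  | base => rfl
  | succ n hn ih =>
    rw [← ih]
    have : gridBlock ρ x n (gridTime (n + 1)) = 0 := by
      rw [gridBlock, block, min_self, if_neg fun h => hhit n hn h.2]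
    simp [capital, this]

/-- A successful block gains its gap exactly, so the new capital forgets all earlier history except
the leftover position in `x`. -/
lemma capital_fst_succ (hhit : ∀ n ≥ N, ¬Unhit x (level ρ n) (gridTime n) (gridTime (n + 1)))
    {n : ℕ} (hn : N ≤ n) : (capital ρ x z (n + 1)).1
      = z (gridTime n) - (capital ρ x z N).2 * x (gridTime n) := by
  have h1 : gridBlock ρ x n (gridTime (n + 1)) = 0 := by
    rw [gridBlock, block, min_self, if_neg fun h => hhit n hn h.2]
  have h2 : blockValue x (level ρ n) (gridTime n) (gridTime (n + 1)) = 1 := by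
    rw [blockValue, if_neg (hhit n hn)]
  simp only [capital, h1, h2, capital_snd_eq hhit hn]
  ring

lemma gap_succ (hhit : ∀ n ≥ N, ¬Unhit x (level ρ n) (gridTime n) (gridTime (n + 1)))
    {n : ℕ} (hn : N ≤ n) : gap ρ x z (n + 1) = (z (gridTime (n + 1)) - z (gridTime n))
      - (capital ρ x z N).2 * (x (gridTime (n + 1)) - x (gridTime n)) := by
  rw [gap, capital_fst_succ hhit hn, capital_snd_eq hhit (hn.trans n.le_succ)]
  ring

/-- By `sum_gain` the partial sums are the capital evaluated at time `1`, eventually `z (gridTime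
n)` plus the leftover position times `x 1 - x (gridTime n)`. -/
lemma tendsto_sum_gain (hx : Continuous (ext01 x)) (hz : Continuous (ext01 z))
    (hhit : ∀ n ≥ N, ¬Unhit x (level ρ n) (gridTime n) (gridTime (n + 1))) :
    Tendsto (fun n => ∑ k ∈ Finset.range n, gain ρ x z k) atTop (𝓝 (z 1)) := by
  rw [← tendsto_add_atTop_iff_nat 1]
  have hlim : ∀ y : I → ℝ, Continuous (ext01 y) →
      Tendsto (fun n => y (gridTime n)) atTop (𝓝 (y 1)) := fun y hy => by
    have := (hy.tendsto 1).comp tendsto_coe_gridTime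
    rw [show ext01 y 1 = y 1 from ext01_coe y 1] at this
    simpa only [Function.comp_def, ext01_coe] using this
  have h := (hlim z hz).add (((hlim x hx).const_sub (x 1)).const_mul (capital ρ x z N).2)
  rw [sub_self, mul_zero, add_zero] at h
  refine h.congr' ?_
  filter_upwards [eventually_ge_atTop N] with n hn
  rw [sum_gain, capital_fst_succ hhit hn, capital_snd_eq hhit (hn.trans n.le_succ)]
  ring

/-- The pathwise representation. -/
theorem hasIntegral_integrand {β r a C C' κ : ℝ} (hx : IsHolder C r (ext01 x))
    (hz : IsHolder C' a (ext01 z)) (hβ0 : 0 < β) (hβ1 : β < 1) (hβr : β < r) (hβr' : 1 - β < r)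
    (hκ : 0 < κ) (hκa : κ ≤ a) (hκr : κ ≤ r) (hθ : 0 < κ - 2 * ρ + 1 + r - β)
    (hhit : ∀ᶠ n in atTop, ¬Unhit x (level ρ n) (gridTime n) (gridTime (n + 1))) :
    HasIntegral β 0 1 (ext01 (integrand ρ x z)) (ext01 x) (z 1) := by
  obtain ⟨N, hN⟩ := eventually_atTop.1 hhit
  obtain ⟨M, hM⟩ := exists_bound_deriv_deriv_hump
  have hr : 0 < r := hβ0.trans hβr
  have hxc := hx.continuous hr
  have hzc := hz.continuous (hκ.trans_le hκa)
  have hC := hx.nonneg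
  have hC' := hz.nonneg
  have hM0 : 0 ≤ M := (abs_nonneg _).trans (hM 0)
  set D := gap ρ x z with hD
  set τ : ℕ → ℝ := fun n => hitTime x (level ρ n) (gridTime n) (gridTime (n + 1)) with hτ
  have hmono : ∀ n, gridTime n ≤ gridTime (n + 1) := fun n =>
    gridTime_strictMono.monotone n.le_succ
  have hcτ : ∀ n, (gridTime n : ℝ) ≤ τ n := fun n => le_hitTime_left (hmono n)
  have hτd : ∀ n, τ n ≤ gridTime (n + 1) := fun n => hitTime_le_right
  -- For a fixed path the gap is just a number, so it is absorbed into the function to which the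
  -- chain rule applies.
  set F : ℕ → ℝ → ℝ := fun n =>
    frozen (fun y => D n * bump (level ρ n) y) (ext01 x) (gridTime n) (τ n) with hF
  have hder : ∀ n y, HasDerivAt (fun y => D n * bump (level ρ n) y)
      (D n * bumpDeriv (level ρ n) y) y := fun n y => (hasDerivAt_bump _ y).const_mul _
  have hderb : ∀ n y, |D n * bumpDeriv (level ρ n) y| ≤ |D n| * (M / level ρ n ^ 2) :=
    fun n y => by
      rw [abs_mul]
      exact mul_le_mul_of_nonneg_left (abs_bumpDeriv_le hM (level_pos ρ n) y) (abs_nonneg _)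
  have hFh : ∀ n, IsHolder (|D n| * (M / level ρ n ^ 2) * C) r (F n) := fun n =>
    hx.frozen hr.le (isHolder_one_of_hasDerivAt (hder n) (hderb n))
  have hF0 : ∀ n, ∀ s ≤ (gridTime n : ℝ), F n s = 0 := fun n s hs =>
    frozen_of_le (hcτ n) (by simp [bump_zero]) hs
  have hFeq : ∀ n (t : I), F n t = D n * gridBlock ρ x n t := fun n t => by
    rw [gridBlock_eq_frozen hxc]; rfl
  have hFm : ∀ n, Measurable (F n) := fun n => ((hFh n).continuous hr).measurable
  have hmeas : Measurable (ext01 (integrand ρ x z)) := by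
    have h : ext01 (integrand ρ x z)
        = fun s => ∑' n, F n (projIcc (0 : ℝ) 1 zero_le_one s : I) := by
      ext s
      simp_rw [hFeq]
      rfl
    rw [h]
    have hp : Measurable fun s : ℝ => ((projIcc (0 : ℝ) 1 zero_le_one s : I) : ℝ) :=
      (continuous_subtype_val.comp continuous_projIcc).measurable
    exact Measurable.tsum fun n => (hFm n).comp hp
  -- Before time `1` only finitely many terms are nonzero. Nothing is claimed at `1`, a single point
  -- that the integral does not see.
  have hsum : ∀ s ∈ Ico (0 : ℝ) 1, HasSum (fun n => F n s) (ext01 (integrand ρ x z) s) :=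
    fun s hs => by
      have h := hasSum_integrand (ρ := ρ) (x := x) (z := z) (t := ⟨s, hs.1, hs.2.le⟩) hs.2
      rw [show ext01 (integrand ρ x z) s = integrand ρ x z ⟨s, hs.1, hs.2.le⟩ from
        ext01_coe _ (⟨s, hs.1, hs.2.le⟩ : I)]
      refine h.congr_fun fun n => ?_
      exact hFeq n ⟨s, hs.1, hs.2.le⟩
  have hJ : ∀ n, ∫ y in (0 : ℝ)..1, marchaud β (F n) y * marchaud (1 - β) (reflect (ext01 x)) (1 - y)
      = -(Real.Gamma β * Real.Gamma (1 - β) * gain ρ x z n) := fun n => by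
    rw [hF, integral_marchaud_frozen (K := fun y => D n * profile (level ρ n) y) hβ0 hβ1 hβr hβr' hx
      (gridTime n).2.1 (hcτ n) ((hτd n).trans (gridTime (n + 1)).2.2)
      (fun y => (hasDerivAt_profile _ y).const_mul _) (hder n)
      (continuous_const.mul (continuous_bumpDeriv _)) (hderb n) (by simp [bump_zero])
      (by simp [profile_zero]), gain, gridBlock, ← block_right (hmono n) (level_pos ρ n) hxc]
    ring
  have hnorm : ∑' n, fracNorm β 0 1 (F n) ≠ ∞ := by
    have hfin : ∀ n, fracNorm β 0 1 (F n) < ∞ := fun n =>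
      (hFh n).fracNorm_lt_top (hF0 n 0 (gridTime n).2.1) hβ0 hβr
    set B := C' + |(capital ρ x z N).2| * C with hB
    have hB0 : 0 ≤ B := by positivity
    set A := 2 + 2 * (1 / (r - β) + 1 / β) with hA
    have hA0 : 0 ≤ A := by
      have : 0 < r - β := sub_pos.2 hβr
      positivity
    set E := A * (B * 2 ^ κ * M * C) with hE
    have hgap : ∀ n ≥ N, |D (n + 1)| ≤ B * 2 ^ κ * gridStep (n + 1) ^ κ := fun n hn => by
      have hinc : ∀ (y : I → ℝ) (K q : ℝ), κ ≤ q → IsHolder K q (ext01 y) →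
          |y (gridTime (n + 1)) - y (gridTime n)| ≤ K * gridStep n ^ κ := fun y K q hq hy => by
        have h := hy (gridTime n) (gridTime (n + 1))
        rw [gridTime_succ_sub, abs_of_pos (gridStep_pos n), ext01_coe, ext01_coe] at h
        exact h.trans (mul_le_mul_of_nonneg_left (Real.rpow_le_rpow_of_exponent_ge
          (gridStep_pos n) (gridStep_lt_one n).le hq) hy.nonneg)
      rw [hD, gap_succ hN hn, mul_assoc, ← Real.mul_rpow (by norm_num) (gridStep_pos _).le,
        ← gridStep_succ]
      refine (abs_sub _ _).trans ?_
      rw [abs_mul, hB, add_mul, mul_assoc]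
      exact add_le_add (hinc z C' a hκa hz)
        (mul_le_mul_of_nonneg_left (hinc x C r hκr hx) (abs_nonneg _))
    -- The exponent collects `κ` from the gap, `-2ρ` from `bumpDeriv` at level `Δ ^ ρ`, and `1 + r -
    -- β` from the short support. The index is shifted because the gap of block `n + 1` is small
    -- only if block `n` succeeded.
    have hbound : ∀ n ≥ N, fracNorm β 0 1 (F (n + 1))
        ≤ ENNReal.ofReal (E * gridStep (n + 1) ^ (κ - 2 * ρ + 1 + r - β)) := fun n hn => by
      have hhit' := hitTime_of_not_unhit hxc le_rfl (hN (n + 1) (hn.trans n.le_succ))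
      have h := (hFh (n + 1)).fracNorm_le_of_support hβ0 hβ1 hβr (half_le_gridTime (n + 1))
        (gridTime_strictMono (n + 1).lt_succ_self) (gridTime (n + 1 + 1)).2.2 (hF0 (n + 1))
        (fun s hs => by
          rw [hF]
          simp only [frozen]
          rw [clamp_of_ge ((hτd (n + 1)).trans hs) (hcτ (n + 1)),
            bump_of_le (level_pos ρ _) hhit'.2, mul_zero])
      rw [gridTime_succ_sub] at h
      refine h.trans (ENNReal.ofReal_le_ofReal ?_)
      have hs := gridStep_pos (n + 1)
      have hlev : level ρ (n + 1) ^ 2 = gridStep (n + 1) ^ (2 * ρ) := by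
        rw [level, ← Real.rpow_natCast, ← Real.rpow_mul hs.le, mul_comm]
        norm_num
      have hpow : gridStep (n + 1) ^ (κ - 2 * ρ + 1 + r - β)
          = gridStep (n + 1) ^ κ / gridStep (n + 1) ^ (2 * ρ)
            * gridStep (n + 1) ^ (1 + r - β) := by
        rw [← Real.rpow_sub hs, ← Real.rpow_add hs]
        congr 1
        ring
      rw [hlev, hpow, hE]
      have h2 : 0 < gridStep (n + 1) ^ (2 * ρ) := Real.rpow_pos_of_pos hs _
      have h3 : 0 < gridStep (n + 1) ^ (1 + r - β) := Real.rpow_pos_of_pos hs _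
      calc A * (|D (n + 1)| * (M / gridStep (n + 1) ^ (2 * ρ)) * C)
            * gridStep (n + 1) ^ (1 + r - β)
          ≤ A * (B * 2 ^ κ * gridStep (n + 1) ^ κ * (M / gridStep (n + 1) ^ (2 * ρ)) * C)
            * gridStep (n + 1) ^ (1 + r - β) := by
            gcongr
            exact hgap n hn
        _ = _ := by ring
    rw [← ENNReal.summable.sum_add_tsum_nat_add' (k := N + 1)]
    refine ENNReal.add_ne_top.2 ⟨(ENNReal.sum_lt_top.2 fun n _ => hfin n).ne, ?_⟩
    have hsm := ((summable_nat_add_iff (N + 1)).2 (summable_gridStep_rpow hθ)).mul_left E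
    refine ne_top_of_le_ne_top hsm.tsum_ofReal_ne_top (ENNReal.tsum_le_tsum fun n => ?_)
    exact hbound (n + N) (Nat.le_add_left N n)
  obtain ⟨j, hj1, hj2⟩ := hasIntegral_of_hasSum hβ0 hβ1 hβr' hmeas hFm hx hsum hnorm hJ
  rwa [← tendsto_nhds_unique hj1.tendsto_sum_nat (tendsto_sum_gain hxc hzc hN)]

end Path

/-! ### Adaptedness and the small ball estimate -/

lemma IsHolder.eq_of_one_lt {C r : ℝ} {f : ℝ → ℝ} (hf : IsHolder C r f) (hr : 1 < r) (s t : ℝ) :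
    f s = f t := by
  have hd : ∀ s, HasDerivAt f 0 s := fun s => by
    rw [hasDerivAt_iff_tendsto]
    have h0 : Tendsto (fun t : ℝ => C * |t - s| ^ (r - 1)) (𝓝 s) (𝓝 0) := by
      have : Continuous fun t : ℝ => C * |t - s| ^ (r - 1) :=
        continuous_const.mul ((continuous_id.sub continuous_const).abs.rpow_const
          fun _ => Or.inr (by linarith))
      simpa [Real.zero_rpow (by linarith : r - 1 ≠ 0)] using this.tendsto s
    refine squeeze_zero (fun t => by positivity) (fun t => ?_) h0
    rcases eq_or_ne t s with rfl | hts
    · simpa using mul_nonneg hf.nonneg (Real.rpow_nonneg le_rfl _)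
    · have hpos : 0 < |t - s| := abs_pos.2 (sub_ne_zero.2 hts)
      rw [smul_zero, sub_zero, Real.norm_eq_abs, Real.norm_eq_abs, inv_mul_le_iff₀ hpos]
      calc |f t - f s| ≤ C * |t - s| ^ r := hf s t
        _ = |t - s| * (C * |t - s| ^ (r - 1)) := by
          rw [Real.rpow_sub_one hpos.ne']
          field_simp
  exact is_const_of_deriv_eq_zero (fun s => (hd s).differentiableAt) (fun s => (hd s).deriv) s t

lemma measurable_tsum_real {Ω : Type*} {m : MeasurableSpace Ω} {f : ℕ → Ω → ℝ}
    (hf : ∀ n, Measurable (f n)) : Measurable fun ω => ∑' n, f n ω :=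
  Measurable.tsum hf

section Adapted

variable {Ω : Type*} [mΩ : MeasurableSpace Ω] {P : Measure Ω} {𝓕 : Filtration I mΩ}
  {X z : I → Ω → ℝ}

lemma HolderPaths.ae_isHolder {Y : I → Ω → ℝ} {r : ℝ} (h : HolderPaths P Y r) (hr : 0 ≤ r) :
    ∀ᵐ ω ∂P, ∃ C, IsHolder C r (ext01 fun t => Y t ω) := by
  filter_upwards [h] with ω ⟨C, hC⟩
  exact ⟨C, isHolder_ext01 hr hC⟩

/-- Only countably many times, all at most `t`, impose a condition, so neither right-continuity nor
completeness of the filtration is needed. -/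
lemma measurableSet_unhit (hX : StronglyAdapted 𝓕 X) (ε : ℝ) (c t : I) :
    MeasurableSet[𝓕 t] {ω | Unhit (fun s => X s ω) ε c t} := by
  have h : {ω | Unhit (fun s => X s ω) ε c t} = ⋂ k, {ω | c ≤ TopologicalSpace.denseSeq I k →
      TopologicalSpace.denseSeq I k ≤ t →
        |X (TopologicalSpace.denseSeq I k) ω - X c ω| < ε} := by
    ext ω
    simp [Unhit]
  rw [h]
  refine MeasurableSet.iInter fun k => ?_
  by_cases h1 : c ≤ TopologicalSpace.denseSeq I k
  · by_cases h2 : TopologicalSpace.denseSeq I k ≤ t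
    · simp only [h1, h2, forall_const]
      have m1 : Measurable[𝓕 t] (X (TopologicalSpace.denseSeq I k)) :=
        (hX _).measurable.mono (𝓕.mono h2) le_rfl
      have m2 : Measurable[𝓕 t] (X c) := (hX c).measurable.mono (𝓕.mono (h1.trans h2)) le_rfl
      exact continuous_abs.measurable.comp (m1.sub m2) measurableSet_Iio
    · simp [h2]
  · simp [h1]

lemma measurable_block (hX : StronglyAdapted 𝓕 X) (ε : ℝ) (c d t : I) :
    Measurable[𝓕 t] fun ω => block (fun s => X s ω) ε c d t := by
  by_cases hct : c ≤ t
  · have ms : MeasurableSet[𝓕 t] {ω | c ≤ t ∧ Unhit (fun s => X s ω) ε c (min t d)} := by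
      simpa only [hct, true_and] using
        𝓕.mono (min_le_left t d) _ (measurableSet_unhit hX ε c (min t d))
    have m1 : Measurable[𝓕 t] (X (min t d)) :=
      (hX _).measurable.mono (𝓕.mono (min_le_left t d)) le_rfl
    have m2 : Measurable[𝓕 t] (X c) := (hX c).measurable.mono (𝓕.mono hct) le_rfl
    exact Measurable.ite ms ((continuous_bump ε).measurable.comp (m1.sub m2)) measurable_const
  · simp only [block, hct, false_and, if_false]
    exact measurable_const

lemma measurable_blockValue (hX : StronglyAdapted 𝓕 X) (ε : ℝ) {c d : I} (hcd : c ≤ d) :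
    Measurable[𝓕 d] fun ω => blockValue (fun s => X s ω) ε c d := by
  have m2 : Measurable[𝓕 d] (X c) := (hX c).measurable.mono (𝓕.mono hcd) le_rfl
  exact Measurable.ite (measurableSet_unhit hX ε c d)
    ((continuous_profile ε).measurable.comp ((hX d).measurable.sub m2)) measurable_const

lemma measurable_capital (hX : StronglyAdapted 𝓕 X) (hz : StronglyAdapted 𝓕 z) (ρ : ℝ) (n : ℕ) :
    (Measurable[𝓕 (gridTime n)] fun ω =>
      (capital ρ (fun s => X s ω) (fun s => z s ω) n).1) ∧
    (Measurable[𝓕 (gridTime n)] fun ω =>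
      (capital ρ (fun s => X s ω) (fun s => z s ω) n).2) := by
  induction n with
  | zero => exact ⟨measurable_const, measurable_const⟩
  | succ n ih =>
    have hle : gridTime n ≤ gridTime (n + 1) := gridTime_strictMono.monotone n.le_succ
    have m1 := ih.1.mono (𝓕.mono hle) le_rfl
    have m2 := ih.2.mono (𝓕.mono hle) le_rfl
    have mz := (hz (gridTime n)).measurable.mono (𝓕.mono hle) le_rfl
    have mX := (hX (gridTime n)).measurable.mono (𝓕.mono hle) le_rfl
    have mX' := (hX (gridTime (n + 1))).measurable
    have mg := (mz.sub m1).sub (m2.mul mX)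
    have my := measurable_block hX (level ρ n) (gridTime n) (gridTime (n + 1)) (gridTime (n + 1))
    have mv := measurable_blockValue hX (level ρ n) hle
    exact ⟨m1.add (mg.mul (mv.sub (my.mul mX'))), m2.add (mg.mul my)⟩

lemma stronglyAdapted_integrand (hX : StronglyAdapted 𝓕 X) (hz : StronglyAdapted 𝓕 z) (ρ : ℝ) :
    StronglyAdapted 𝓕 fun t ω => integrand ρ (fun s => X s ω) (fun s => z s ω) t := by
  intro t
  suffices hm : ∀ n, Measurable[𝓕 t] fun ω => gap ρ (fun s => X s ω) (fun s => z s ω) n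
      * gridBlock ρ (fun s => X s ω) n t from
    (measurable_tsum_real hm).stronglyMeasurable
  intro n
  by_cases ht : gridTime n ≤ t
  · have h := measurable_capital hX hz ρ n
    have mg : Measurable[𝓕 (gridTime n)] fun ω => gap ρ (fun s => X s ω) (fun s => z s ω) n :=
      ((hz _).measurable.sub h.1).sub (h.2.mul (hX _).measurable)
    exact (mg.mono (𝓕.mono ht) le_rfl).mul (measurable_block hX _ _ _ t)
  · simp_rw [gridBlock_of_le (le_of_not_ge ht), mul_zero]
    exact measurable_const

variable [IsProbabilityMeasure P] {α : ℝ}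

/-- Hölder continuity of all orders below `α` and the small ball estimate force `α ≤ 1`. -/
lemma SmallBall.le_one (hs : SmallBall P X α)
    (hh : ∀ r : ℝ, 0 < r → r < α → HolderPaths P X r) : α ≤ 1 := by
  by_contra! hα
  obtain ⟨δ, hδ, C, hC, h⟩ := hs
  obtain ⟨n, hn⟩ := (tendsto_coe_gridTime.eventually
    (lt_mem_nhds (by linarith : 1 - δ < 1))).exists
  have hlt : (gridTime n : ℝ) < 1 :=
    sub_lt_self _ (by positivity)
  have hΔ : 0 < ((1 : I) : ℝ) - gridTime n := sub_pos.2 hlt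
  have hε := Real.rpow_pos_of_pos hΔ α
  have h1 := h (gridTime n) 1 hn.le le_one' _ hε le_rfl
  -- Paths of Hölder order `(1 + α) / 2 > 1` are constant, so this event has probability one, while
  -- the small ball bound is below one.
  have hconst : ∀ᵐ ω ∂P, ω ∈ {ω | ∀ u ∈ Icc (gridTime n) 1,
      |X u ω - X (gridTime n) ω| ≤ (((1 : I) : ℝ) - gridTime n) ^ α} := by
    filter_upwards [(hh ((1 + α) / 2) (by linarith) (by linarith)).ae_isHolder (by linarith)]
      with ω ⟨K, hK⟩ u _
    have := hK.eq_of_one_lt (by linarith) u (gridTime n)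
    rw [ext01_coe, ext01_coe] at this
    rw [this, sub_self, abs_zero]
    exact hε.le
  have hone : P {ω | ∀ u ∈ Icc (gridTime n) 1,
      |X u ω - X (gridTime n) ω| ≤ (((1 : I) : ℝ) - gridTime n) ^ α} = 1 := by
    rw [← measure_univ (μ := P)]
    exact measure_congr (eventuallyEq_univ.2 hconst)
  rw [measureReal_def, hone, ENNReal.toReal_one] at h1
  have h2 : Real.exp (-C * (((1 : I) : ℝ) - gridTime n)
      * ((((1 : I) : ℝ) - gridTime n) ^ α) ^ (-1 / α)) < 1 := by
    rw [Real.exp_lt_one_iff]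
    have := Real.rpow_pos_of_pos hε (-1 / α)
    have h3 := mul_pos (mul_pos hC hΔ) this
    linarith
  linarith

/-- Almost surely, all but finitely many blocks reach their level. -/
lemma SmallBall.ae_eventually_not_unhit (hs : SmallBall P X α) (hα : 0 < α) {ρ : ℝ} (hρ : α < ρ)
    (hc : ∀ᵐ ω ∂P, Continuous (ext01 fun t => X t ω)) :
    ∀ᵐ ω ∂P, ∀ᶠ n in atTop,
      ¬Unhit (fun t => X t ω) (level ρ n) (gridTime n) (gridTime (n + 1)) := by
  obtain ⟨δ, hδ, C, hC, h⟩ := hs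
  obtain ⟨N, hN⟩ := eventually_atTop.1 (tendsto_coe_gridTime.eventually
    (lt_mem_nhds (by linarith : 1 - δ < 1)))
  set B : ℕ → Set Ω := fun n => {ω | ∀ u ∈ Icc (gridTime n) (gridTime (n + 1)),
    |X u ω - X (gridTime n) ω| ≤ level ρ n} with hB
  have hlt : ∀ n, gridTime n < gridTime (n + 1) := fun n => gridTime_strictMono n.lt_succ_self
  have hη : 0 < ρ / α - 1 := sub_pos.2 ((one_lt_div hα).2 hρ)
  -- With `ε = Δ ^ ρ` the small ball bound is `exp (-C * Δ ^ (1 - ρ / α))`. The crude estimate `exp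
  -- (-y) ≤ 1 / y` already yields a geometric series.
  have hbound : ∀ n ≥ N, P (B n) ≤ ENNReal.ofReal (C⁻¹ * gridStep n ^ (ρ / α - 1)) := fun n hn => by
    have hs := gridStep_pos n
    have h1 := h (gridTime n) (gridTime (n + 1)) (hN n hn).le (hlt n).le (level ρ n)
      (level_pos ρ n) (by
        rw [gridTime_succ_sub]
        exact Real.rpow_le_rpow_of_exponent_ge hs (gridStep_lt_one n).le hρ.le)
    rw [← ofReal_measureReal]
    refine ENNReal.ofReal_le_ofReal (h1.trans ?_)
    have h2 : -C * ((gridTime (n + 1) : ℝ) - gridTime n) * level ρ n ^ (-1 / α)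
        = -(C * gridStep n ^ (-(ρ / α - 1))) := by
      rw [gridTime_succ_sub, level, ← Real.rpow_mul hs.le,
        show -(ρ / α - 1) = 1 + ρ * (-1 / α) by ring, Real.rpow_add hs, Real.rpow_one]
      ring
    have h3 : 0 < C * gridStep n ^ (-(ρ / α - 1)) := mul_pos hC (Real.rpow_pos_of_pos hs _)
    rw [h2, Real.exp_neg]
    calc (Real.exp (C * gridStep n ^ (-(ρ / α - 1))))⁻¹
        ≤ (C * gridStep n ^ (-(ρ / α - 1)))⁻¹ :=
          inv_anti₀ h3 ((le_add_of_nonneg_right zero_le_one).trans (Real.add_one_le_exp _))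
      _ = C⁻¹ * gridStep n ^ (ρ / α - 1) := by
          rw [mul_inv, Real.rpow_neg hs.le, inv_inv]
  have hsum : ∑' n, P (B (n + N)) ≠ ∞ := by
    have hsm := ((summable_nat_add_iff N).2 (summable_gridStep_rpow hη)).mul_left C⁻¹
    exact ne_top_of_le_ne_top hsm.tsum_ofReal_ne_top
      (ENNReal.tsum_le_tsum fun n => hbound (n + N) (Nat.le_add_left N n))
  -- This half of Borel–Cantelli needs no measurability of the events `B n`, which are defined by
  -- uncountably many conditions.
  filter_upwards [ae_eventually_notMem hsum, hc] with ω hω hcω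
  have hcx : Continuous fun t => X t ω := by
    have := hcω.comp (continuous_subtype_val (p := fun t : ℝ => t ∈ I))
    simpa only [Function.comp_def, ext01_coe] using this
  have hω' : ∀ᶠ n in atTop, ω ∉ B n := by
    obtain ⟨M, hM⟩ := eventually_atTop.1 hω
    refine eventually_atTop.2 ⟨M + N, fun n hn => ?_⟩
    have := hM (n - N) (by omega)
    rwa [Nat.sub_add_cancel (by omega)] at this
  filter_upwards [hω'] with n hn
  refine not_unhit_of_exists hcx (hlt n) ?_
  by_contra! hcon
  exact hn hcon

end Adapted

end GLS

end

/-! ### Choice of the exponents -/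

theorem mainTheorem1 {Ω : Type*} [mΩ : MeasurableSpace Ω] (P : Measure Ω) [IsProbabilityMeasure P]
    (𝓕 : Filtration I mΩ) (X : I → Ω → ℝ) (hX : StronglyAdapted 𝓕 X)
    (α : ℝ) (hα : 1 / 2 < α)
    (hX_holder : ∀ r : ℝ, 0 < r → r < α → GLS.HolderPaths P X r)
    (hX_small : GLS.SmallBall P X α)
    (ξ : Ω → ℝ) (z : I → Ω → ℝ) (hz : StronglyAdapted 𝓕 z)
    (a : ℝ) (ha : 0 < a) (hz_holder : GLS.HolderPaths P z a)
    (hξ : ∀ᵐ ω ∂P, z 1 ω = ξ ω) :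
    ∃ ψ : I → Ω → ℝ, StronglyAdapted 𝓕 ψ ∧
      (∀ᵐ ω ∂P, ContinuousOn (fun t : I => ψ t ω) (Iio 1)) ∧
      ∃ β : ℝ, 1 - α < β ∧ 0 < β ∧ β < 1 ∧
        ∀ᵐ ω ∂P, GLS.HasIntegral β 0 1
          (IccExtend zero_le_one fun t : I => ψ t ω)
          (IccExtend zero_le_one fun t : I => X t ω) (ξ ω) := by
  -- Needed for positivity of `β = 1 - α + 2κ`.
  have hα1 : α ≤ 1 := hX_small.le_one hX_holder
  obtain ⟨κ, hκ0, hκa, hκα⟩ : ∃ κ : ℝ, 0 < κ ∧ 40 * κ ≤ a ∧ 40 * κ ≤ 2 * α - 1 := by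
    refine ⟨min a (2 * α - 1) / 40, ?_, ?_, ?_⟩
    · have : 0 < min a (2 * α - 1) := lt_min ha (by linarith)
      positivity
    · linarith [min_le_left a (2 * α - 1)]
    · linarith [min_le_right a (2 * α - 1)]
  have hxh := (hX_holder (α - κ) (by linarith) (by linarith)).ae_isHolder (by linarith)
  have hzh := hz_holder.ae_isHolder ha.le
  have hxc : ∀ᵐ ω ∂P, Continuous (GLS.ext01 fun t => X t ω) := by
    filter_upwards [hxh] with ω ⟨C, hC⟩
    exact hC.continuous (by linarith)
  -- The parameters are `ρ = α + κ`, `r = α - κ`, `β = 1 - α + 2κ` and gap exponent `10κ`. Then `r -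
  -- (1 - β) = κ`, `r - β = 2α - 1 - 3κ > 0`, and the exponent of the block norms is `10κ - 2ρ + 1 +
  -- r - β = 5κ`. The factor `40` in the choice of `κ` is a generous margin.
  refine ⟨fun t ω => GLS.integrand (α + κ) (fun s => X s ω) (fun s => z s ω) t,
    GLS.stronglyAdapted_integrand hX hz _, ?_, 1 - α + 2 * κ, by linarith, by linarith,
    by linarith, ?_⟩
  · filter_upwards [hxc] with ω hω
    exact GLS.continuousOn_integrand hω
  · filter_upwards [hxh, hzh, hξ,
      hX_small.ae_eventually_not_unhit (by linarith) (by linarith : α < α + κ) hxc]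
      with ω ⟨C, hC⟩ ⟨C', hC'⟩ hω hhit
    rw [← hω]
    exact GLS.hasIntegral_integrand hC hC' (by linarith) (by linarith) (by linarith) (by linarith)
      (κ := 10 * κ) (by linarith) (by linarith) (by linarith) (by linarith) hhit
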